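/- Let $n\ge 1$, and let $\langle z,w\rangle=-z^0w^0+z^1w^1+\dots+z^nw^n$ on $\mathbb R^{n+1}$. Let $H^n_{\mathbb R}\subset\mathbb{RP}^n$ be the set of lines spanned by vectors $x$ with $\langle x,x\rangle<0$, with the geodesic distance $d$ given by $\cosh d(x,y)=|\langle x,y\rangle|/(\langle x,x\rangle\langle y,y\rangle)^{1/2}$, and let $G=O(1,n)$ be the subgroup of $GL(n+1,\mathbb R)$ preserving $\langle\cdot,\cdot\rangle$, acting on $H^n_{\mathbb R}$. Let $\mathfrak S$ be the space of hyperplanes of $H^n_{\mathbb R}$, that is, of complete connected totally geodesic submanifolds of codimension one (equivalently, of the subsets $S\subset H^n_{\mathbb R}$ isometric, for the restriction of $d$, to $H^{n-1}_{\mathbb R}$). Let $S_0$ be the hyperplane of points with last coordinate zero, $G(S_0)$ its stabilizer in $G$, and give $\mathfrak S$ the topology of the homogeneous space $G/G(S_0)$, i.e. the quotient topology for the map $g\mapsto gS_0$ from $G$ to $\mathfrak S$. Let $[xy]$ denote the geodesic segment between $x,y\in H^n_{\mathbb R}$. Then there is a nonzero $G$-invariant Borel measure on $\mathfrak S$ that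 is finite on compact sets. Moreover, for every such measure $\mu_{\mathfrak S}$ there is a constant $k>0$ such that, for all $x,y\in H^n_{\mathbb R}$, the set $\{S\in\mathfrak S: S\cap[xy]\ne\emptyset\}$ is Borel and $$\mu_{\mathfrak S}\{S\in\mathfrak S: S\cap[xy]\neq\emptyset\}=k\,d(x,y).$$ -/

import Mathlib

open MeasureTheory Set
open scoped LinearAlgebra.Projectivization MatrixGroups Matrix Pointwise

noncomputable section

namespace HypCrofton

/-- The Lorentz form `⟨z, w⟩ = - z⁰ w⁰ + z¹ w¹ + ⋯ + zⁿ wⁿ` on `ℝⁿ⁺¹`. -/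
def lorentz {n : ℕ} (z w : Fin (n + 1) → ℝ) : ℝ :=
  -(z 0 * w 0) + ∑ i : Fin n, z i.succ * w i.succ

theorem lorentz_smul {n : ℕ} (a b : ℝ) (z w : Fin (n + 1) → ℝ) :
    lorentz (a • z) (b • w) = a * b * lorentz z w := by
  simp only [lorentz, Pi.smul_apply, smul_eq_mul, mul_add, Finset.mul_sum]
  congr 1
  · ring
  · exact Finset.sum_congr rfl fun i _ => by ring

/-- Real hyperbolic space `Hⁿ`: the set of negative lines in the real projective space
`ℙ(ℝⁿ⁺¹)`. -/
def HypSpace (n : ℕ) : Type :=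
  {p : ℙ ℝ (Fin (n + 1) → ℝ) // lorentz p.rep p.rep < 0}

theorem exists_rep_eq {n : ℕ} (v : Fin (n + 1) → ℝ) (hv : v ≠ 0) :
    ∃ a : ℝ, a ≠ 0 ∧ (Projectivization.mk ℝ v hv).rep = a • v := by
  obtain ⟨a, ha⟩ := Projectivization.exists_smul_eq_mk_rep ℝ v hv
  exact ⟨a, a.ne_zero, ha.symm⟩

/-- Negativity of a line can be tested on any of its nonzero vectors. -/
theorem lorentz_rep_neg_iff {n : ℕ} (v : Fin (n + 1) → ℝ) (hv : v ≠ 0) :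
    lorentz (Projectivization.mk ℝ v hv).rep (Projectivization.mk ℝ v hv).rep < 0 ↔
      lorentz v v < 0 := by
  obtain ⟨a, ha, h⟩ := exists_rep_eq v hv
  rw [h, lorentz_smul]
  have : 0 < a * a := mul_self_pos.2 ha
  constructor
  · intro h
    by_contra! h'
    exact absurd h (not_lt.2 (mul_nonneg this.le h'))
  · exact fun h => mul_neg_of_pos_of_neg this h

/-- The point of hyperbolic space represented by a negative vector. -/
def HypSpace.mk {n : ℕ} (v : Fin (n + 1) → ℝ) (hv : v ≠ 0) (h : lorentz v v < 0) :
    HypSpace n :=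
  ⟨Projectivization.mk ℝ v hv, (lorentz_rep_neg_iff v hv).2 h⟩

theorem HypSpace.exists_mk {n : ℕ} (p : HypSpace n) :
    ∃ (v : Fin (n + 1) → ℝ) (hv : v ≠ 0) (h : lorentz v v < 0), p = HypSpace.mk v hv h :=
  ⟨p.1.rep, p.1.rep_nonzero, p.2, Subtype.ext p.1.mk_rep.symm⟩

/-- The geodesic distance: `cosh d(x, y) = |⟨x, y⟩| / (⟨x, x⟩ ⟨y, y⟩)^(1/2)`. -/
def hdist {n : ℕ} (x y : HypSpace n) : ℝ :=
  Real.arcosh (|lorentz x.1.rep y.1.rep| /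
    Real.sqrt (lorentz x.1.rep x.1.rep * lorentz y.1.rep y.1.rep))

/-- The distance does not depend on the vectors that represent the two points. -/
theorem hdist_mk {n : ℕ} (v w : Fin (n + 1) → ℝ) (hv : v ≠ 0) (hw : w ≠ 0)
    (hv' : lorentz v v < 0) (hw' : lorentz w w < 0) :
    hdist (HypSpace.mk v hv hv') (HypSpace.mk w hw hw') =
      Real.arcosh (|lorentz v w| / Real.sqrt (lorentz v v * lorentz w w)) := by
  obtain ⟨a, ha, h⟩ := exists_rep_eq v hv
  obtain ⟨b, hb, h'⟩ := exists_rep_eq w hw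
  unfold hdist
  simp only [HypSpace.mk, h, h', lorentz_smul]
  have h1 : a * a * lorentz v v * (b * b * lorentz w w)
      = (a * b) ^ 2 * (lorentz v v * lorentz w w) := by ring
  rw [h1, Real.sqrt_mul (sq_nonneg _), Real.sqrt_sq_eq_abs, abs_mul,
    mul_div_mul_left _ _ (abs_ne_zero.2 (mul_ne_zero ha hb))]

/-- The group `O(1, n)`: the subgroup of `GL(n + 1, ℝ)` that preserves the Lorentz form, with
the subspace topology. -/
def lorentzGroup (n : ℕ) : Subgroup (GL (Fin (n + 1)) ℝ) where
  carrier := {g | ∀ z w : Fin (n + 1) → ℝ, lorentz (g • z) (g • w) = lorentz z w}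
  mul_mem' := by
    intro g h hg hh z w
    rw [mul_smul, mul_smul, hg, hh]
  one_mem' := by
    intro z w
    rw [one_smul, one_smul]
  inv_mem' := by
    intro g hg z w
    rw [← hg, smul_inv_smul, smul_inv_smul]

theorem smul_neg_mem {n : ℕ} (g : lorentzGroup n) (p : HypSpace n) :
    lorentz (g.1 • p.1).rep (g.1 • p.1).rep < 0 := by
  obtain ⟨v, hv, h, rfl⟩ := p.exists_mk
  simp only [HypSpace.mk, Projectivization.smul_mk]
  rw [lorentz_rep_neg_iff, g.2]
  exact h

/-- The action of `O(1, n)` on hyperbolic space induced by its linear action on `ℝⁿ⁺¹`. -/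
instance (n : ℕ) : MulAction (lorentzGroup n) (HypSpace n) where
  smul g p := ⟨g.1 • p.1, smul_neg_mem g p⟩
  one_smul p := Subtype.ext (one_smul _ p.1)
  mul_smul g h p := Subtype.ext (mul_smul g.1 h.1 p.1)

theorem smul_mk {n : ℕ} (g : lorentzGroup n) (v : Fin (n + 1) → ℝ) (hv : v ≠ 0)
    (h : lorentz v v < 0) :
    g • HypSpace.mk v hv h =
      HypSpace.mk (g.1 • v) ((smul_ne_zero_iff_ne g.1).mpr hv) (by rw [g.2]; exact h) :=
  rfl

theorem hdist_smul {n : ℕ} (g : lorentzGroup n) (x y : HypSpace n) :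
    hdist (g • x) (g • y) = hdist x y := by
  obtain ⟨v, hv, h, rfl⟩ := x.exists_mk
  obtain ⟨w, hw, h', rfl⟩ := y.exists_mk
  rw [smul_mk, smul_mk, hdist_mk, hdist_mk, g.2, g.2, g.2]

/-- The geodesic segment `[xy]`: the union of the images of the geodesics from `x` to `y`
parametrized by arc length (there is exactly one). -/
def geodesicSegment {n : ℕ} (x y : HypSpace n) : Set (HypSpace n) :=
  {z | ∃ γ : ℝ → HypSpace n, γ 0 = x ∧ γ (hdist x y) = y ∧
    (∀ s ∈ Icc 0 (hdist x y), ∀ t ∈ Icc 0 (hdist x y), hdist (γ s) (γ t) = |s - t|) ∧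
    ∃ t ∈ Icc 0 (hdist x y), γ t = z}

/-- Totally geodesic hyperplanes of `Hⁿ⁺¹`. A complete connected totally geodesic submanifold
of codimension one is the same thing as a subset that is, for the geodesic distance, an
isometrically embedded copy of `Hⁿ`. For `n = 0` these are the points of the line `H¹`. -/
def IsHyperplane {n : ℕ} (S : Set (HypSpace (n + 1))) : Prop :=
  ∃ f : HypSpace n → HypSpace (n + 1),
    (∀ x y, hdist (f x) (f y) = hdist x y) ∧ range f = S

/-- The space `𝔖` of totally geodesic hyperplanes of `Hⁿ⁺¹`. -/
def Hyperplane (n : ℕ) : Type := {S : Set (HypSpace (n + 1)) // IsHyperplane S}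

theorem IsHyperplane.smul {n : ℕ} (g : lorentzGroup (n + 1)) {S : Set (HypSpace (n + 1))}
    (hS : IsHyperplane S) : IsHyperplane (g • S) := by
  obtain ⟨f, hf, rfl⟩ := hS
  refine ⟨fun x => g • f x, fun x y => by rw [hdist_smul, hf], ?_⟩
  ext p
  simp [Set.mem_smul_set]

/-- `O(1, n + 1)` acts on the space of hyperplanes by `g • S = {g x : x ∈ S}`. -/
instance (n : ℕ) : MulAction (lorentzGroup (n + 1)) (Hyperplane n) where
  smul g S := ⟨g • S.1, S.2.smul g⟩
  one_smul S := Subtype.ext (one_smul _ S.1)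
  mul_smul g h S := Subtype.ext (mul_smul g h S.1)

/-- The points of `Hⁿ⁺¹` whose last homogeneous coordinate vanishes. -/
def stdSet (n : ℕ) : Set (HypSpace (n + 1)) := {p | p.1.rep (Fin.last (n + 1)) = 0}

theorem lorentz_snoc {n : ℕ} (v w : Fin (n + 1) → ℝ) :
    lorentz (n := n + 1) (Fin.snoc (α := fun _ => ℝ) v 0) (Fin.snoc (α := fun _ => ℝ) w 0)
      = lorentz v w := by
  have h0 (u : Fin (n + 1) → ℝ) : Fin.snoc (α := fun _ : Fin (n + 2) => ℝ) u 0 0 = u 0 :=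
    Fin.snoc_castSucc (α := fun _ : Fin (n + 2) => ℝ) (0 : ℝ) u 0
  have h1 (u : Fin (n + 1) → ℝ) (i : Fin n) :
      Fin.snoc (α := fun _ : Fin (n + 2) => ℝ) u 0 i.castSucc.succ = u i.succ := by
    rw [Fin.succ_castSucc]
    exact Fin.snoc_castSucc (α := fun _ : Fin (n + 2) => ℝ) (0 : ℝ) u i.succ
  have h2 (u : Fin (n + 1) → ℝ) :
      Fin.snoc (α := fun _ : Fin (n + 2) => ℝ) u 0 (Fin.last n).succ = 0 := by
    rw [Fin.succ_last]
    exact Fin.snoc_last (α := fun _ : Fin (n + 2) => ℝ) (0 : ℝ) u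
  unfold lorentz
  rw [Fin.sum_univ_castSucc, h0, h0]
  simp only [h1, h2, mul_zero, add_zero]

theorem snoc_ne_zero {n : ℕ} {v : Fin (n + 1) → ℝ} (hv : v ≠ 0) :
    (Fin.snoc (α := fun _ => ℝ) v 0 : Fin (n + 2) → ℝ) ≠ 0 := by
  intro h
  refine hv (funext fun i => ?_)
  have := congrFun h i.castSucc
  rwa [Fin.snoc_castSucc] at this

theorem isHyperplane_stdSet (n : ℕ) : IsHyperplane (stdSet n) := by
  refine ⟨fun x => HypSpace.mk (n := n + 1) (Fin.snoc (α := fun _ => ℝ) x.1.rep 0)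
    (snoc_ne_zero x.1.rep_nonzero) (by rw [lorentz_snoc]; exact x.2), fun x y => ?_, ?_⟩
  · rw [hdist_mk, lorentz_snoc, lorentz_snoc, lorentz_snoc]
    rfl
  · ext p
    constructor
    · rintro ⟨x, rfl⟩
      obtain ⟨a, -, h⟩ := exists_rep_eq (n := n + 1) _ (snoc_ne_zero x.1.rep_nonzero)
      refine (congrFun h (Fin.last (n + 1))).trans ?_
      rw [Pi.smul_apply, Fin.snoc_last, smul_zero]
    · intro hp
      set u : Fin (n + 1) → ℝ := fun i => p.1.rep i.castSucc with hu
      have hsn : (Fin.snoc (α := fun _ => ℝ) u 0 : Fin (n + 2) → ℝ) = p.1.rep := by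
        funext i
        refine Fin.lastCases ?_ (fun j => ?_) i
        · rw [Fin.snoc_last]; exact hp.symm
        · rw [Fin.snoc_castSucc]
      have hneg : lorentz u u < 0 := by
        rw [← lorentz_snoc, hsn]; exact p.2
      have hu0 : u ≠ 0 := by
        intro h
        rw [h] at hneg
        simp [lorentz] at hneg
      refine ⟨HypSpace.mk u hu0 hneg, Subtype.ext ?_⟩
      obtain ⟨a, ha, h⟩ := exists_rep_eq u hu0
      change Projectivization.mk ℝ _ _ = p.1
      conv_rhs => rw [← p.1.mk_rep]
      rw [Projectivization.mk_eq_mk_iff']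
      refine ⟨a, ?_⟩
      rw [← hsn]
      change _ = (Fin.snoc (α := fun _ => ℝ) (Projectivization.mk ℝ u hu0).rep 0 :
        Fin (n + 2) → ℝ)
      rw [h]
      funext i
      refine Fin.lastCases ?_ (fun j => ?_) i
      · rw [Pi.smul_apply, Fin.snoc_last, Fin.snoc_last, smul_zero]
      · rw [Pi.smul_apply, Fin.snoc_castSucc, Fin.snoc_castSucc, Pi.smul_apply]

/-- The hyperplane `S₀`, the naturally embedded copy of `Hⁿ` in `Hⁿ⁺¹`. -/
def stdHyperplane (n : ℕ) : Hyperplane n := ⟨stdSet n, isHyperplane_stdSet n⟩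

/-- The topology of the homogeneous space `G / G(S₀)`, where `G = O(1, n + 1)`: the quotient
topology for the orbit map `G → 𝔖`, `g ↦ g • S₀`. -/
instance (n : ℕ) : TopologicalSpace (Hyperplane n) :=
  TopologicalSpace.coinduced (fun g : lorentzGroup (n + 1) => g • stdHyperplane n) inferInstance

/-- The Borel sets of the space of hyperplanes. -/
instance (n : ℕ) : MeasurableSpace (Hyperplane n) := borel _

instance (n : ℕ) : BorelSpace (Hyperplane n) := ⟨rfl⟩

/-- A nonzero `O(1, n + 1)`-invariant Borel measure on the space of hyperplanes of `Hⁿ⁺¹` that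
is finite on compact sets. -/
structure IsInvariantMeasure {n : ℕ} (μ : Measure (Hyperplane n)) : Prop where
  ne_zero : μ ≠ 0
  invariant : ∀ (g : lorentzGroup (n + 1)) (A : Set (Hyperplane n)), MeasurableSet A →
    μ ((fun S => g • S) '' A) = μ A
  lt_top_of_isCompact : ∀ A : Set (Hyperplane n), IsCompact A → μ A < ⊤

end HypCrofton

end

/-!
A hyperplane of hyperbolic space is the orthogonal complement of a spacelike vector `v`, unique up
to scaling (`exists_eq_perp`). It meets a segment `[xy]` exactly when the Lorentz products of `v`
with the representatives of `x` and `y` on the upper sheet of the hyperboloid do not have the same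
strict sign (`perp_inter_geodesicSegment_nonempty_iff`). Reflections show that the hyperplane
depends continuously on its normal vector (`continuousOn_normalMap`), so that the set `meeting x y`
of hyperplanes meeting `[xy]` is closed and contained in a compact set.

Existence: Lebesgue measure on the spacelike vectors `w` with `⟨w, w⟩ ≤ 1` is invariant, as Lorentz
transformations have determinant `±1`. Its image `coneMeasure` on the space of hyperplanes is finite
on compact sets, because the normal vectors `w` with `⟨w, w⟩ ≤ 1` of the hyperplanes meeting a given
ball form a bounded set.

Proportionality: no uniqueness theorem for invariant measures is needed. Given an invariant measure
`μ`, two-point homogeneity (`exists_smul_pair`) makes `μ (meeting x y)` a function of `d(x, y)`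
alone. The hyperplanes through a point are a null set (`measure_meeting_self`): all points give the
same measure, and there are infinitely many points in a ball, taken from a moment curve, of which
every hyperplane contains only finitely many. Hence the function is additive
(`measure_meeting_axis_add`), and, being nonnegative and finite, it is linear. Its slope is not
zero, because countably many of the sets `meeting x y` cover the space of hyperplanes
(`exists_countable_cover`).
-/

noncomputable section

namespace HypCrofton

/-! ### The Lorentz form -/

section Lorentz

variable {n : ℕ}

theorem lorentz_comm (z w : Fin (n + 1) → ℝ) : lorentz z w = lorentz w z := by
  simp only [lorentz, mul_comm]

theorem lorentz_add_left (a b w : Fin (n + 1) → ℝ) :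
    lorentz (a + b) w = lorentz a w + lorentz b w := by
  simp only [lorentz, Pi.add_apply, add_mul, Finset.sum_add_distrib]
  ring

theorem lorentz_smul_left (c : ℝ) (a w : Fin (n + 1) → ℝ) :
    lorentz (c • a) w = c * lorentz a w := by
  simpa using lorentz_smul c 1 a w

theorem lorentz_add_right (w a b : Fin (n + 1) → ℝ) :
    lorentz w (a + b) = lorentz w a + lorentz w b := by
  rw [lorentz_comm, lorentz_add_left, lorentz_comm a, lorentz_comm b]

theorem lorentz_smul_right (c : ℝ) (w a : Fin (n + 1) → ℝ) :
    lorentz w (c • a) = c * lorentz w a := by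
  rw [lorentz_comm, lorentz_smul_left, lorentz_comm]

theorem lorentz_neg_left (a w : Fin (n + 1) → ℝ) : lorentz (-a) w = -lorentz a w := by
  simpa using lorentz_smul_left (-1) a w

theorem lorentz_neg_right (w a : Fin (n + 1) → ℝ) : lorentz w (-a) = -lorentz w a := by
  simpa using lorentz_smul_right (-1) w a

theorem lorentz_sub_left (a b w : Fin (n + 1) → ℝ) :
    lorentz (a - b) w = lorentz a w - lorentz b w := by
  rw [sub_eq_add_neg, lorentz_add_left, lorentz_neg_left, sub_eq_add_neg]

theorem lorentz_sub_right (w a b : Fin (n + 1) → ℝ) :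
    lorentz w (a - b) = lorentz w a - lorentz w b := by
  rw [sub_eq_add_neg, lorentz_add_right, lorentz_neg_right, sub_eq_add_neg]

theorem lorentz_self (w : Fin (n + 1) → ℝ) :
    lorentz w w = -(w 0) ^ 2 + ∑ i : Fin n, w i.succ ^ 2 := by
  simp only [lorentz, pow_two]

theorem continuous_lorentz :
    Continuous fun p : (Fin (n + 1) → ℝ) × (Fin (n + 1) → ℝ) => lorentz p.1 p.2 := by
  unfold lorentz
  fun_prop

theorem _root_.Continuous.lorentz {X : Type*} [TopologicalSpace X] {f g : X → Fin (n + 1) → ℝ}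
    (hf : Continuous f) (hg : Continuous g) :
    Continuous fun x => HypCrofton.lorentz (f x) (g x) :=
  continuous_lorentz.comp (hf.prodMk hg)

/-- A vector orthogonal to a point of the hyperboloid is spacelike; quantitatively, its time
coordinate is controlled by its length. -/
theorem sq_zero_le_of_orthogonal {w p : Fin (n + 1) → ℝ} (h : lorentz w p = 0)
    (hp : lorentz p p = -1) : w 0 ^ 2 ≤ (p 0 ^ 2 - 1) * lorentz w w := by
  have hcs := Finset.sum_mul_sq_le_sq_mul_sq Finset.univ (fun i : Fin n => w i.succ)
    (fun i : Fin n => p i.succ)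
  have h1 : ∑ i : Fin n, w i.succ * p i.succ = w 0 * p 0 := by
    unfold lorentz at h; linarith
  have h2 : ∑ i : Fin n, p i.succ ^ 2 = p 0 ^ 2 - 1 := by
    rw [lorentz_self] at hp; linarith
  have h3 : ∑ i : Fin n, w i.succ ^ 2 = lorentz w w + w 0 ^ 2 := by
    rw [lorentz_self]; ring
  rw [h1, h2, h3] at hcs
  linarith

theorem one_le_sq_zero {p : Fin (n + 1) → ℝ} (hp : lorentz p p = -1) : 1 ≤ p 0 ^ 2 := by
  have : 0 ≤ ∑ i : Fin n, p i.succ ^ 2 := Finset.sum_nonneg fun i _ => sq_nonneg _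
  rw [lorentz_self] at hp
  linarith

theorem one_le_zero {p : Fin (n + 1) → ℝ} (hp : lorentz p p = -1) (h0 : 0 < p 0) : 1 ≤ p 0 := by
  nlinarith [one_le_sq_zero hp]

theorem eq_zero_of_orthogonal {w p : Fin (n + 1) → ℝ} (h : lorentz w p = 0)
    (hp : lorentz p p = -1) (hw : lorentz w w ≤ 0) : w = 0 := by
  have h1 := sq_zero_le_of_orthogonal h hp
  have h2 := one_le_sq_zero hp
  have h3 : w 0 ^ 2 ≤ 0 := h1.trans (mul_nonpos_of_nonneg_of_nonpos (by linarith) hw)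
  have h4 : w 0 ^ 2 = 0 := le_antisymm h3 (sq_nonneg _)
  rw [lorentz_self, h4] at hw
  have hs : ∀ i ∈ (Finset.univ : Finset (Fin n)), 0 ≤ w i.succ ^ 2 := fun i _ => sq_nonneg _
  have h5 := (Finset.sum_eq_zero_iff_of_nonneg hs).1
    (le_antisymm (by linarith) (Finset.sum_nonneg hs))
  funext i
  refine Fin.cases (by simpa using h4) (fun j => ?_) i
  simpa using h5 j (Finset.mem_univ _)

/-- The reverse Cauchy–Schwarz inequality on the upper sheet of the hyperboloid. -/
theorem lorentz_le_neg_one {p q : Fin (n + 1) → ℝ} (hp : lorentz p p = -1)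
    (hq : lorentz q q = -1) (hp0 : 0 < p 0) (hq0 : 0 < q 0) : lorentz p q ≤ -1 := by
  have hcs := Finset.sum_mul_sq_le_sq_mul_sq Finset.univ (fun i : Fin n => p i.succ)
    (fun i : Fin n => q i.succ)
  have h1 := one_le_zero hp hp0
  have h2 := one_le_zero hq hq0
  rw [lorentz_self] at hp hq
  have h3 : ∑ i : Fin n, p i.succ ^ 2 = p 0 ^ 2 - 1 := by linarith
  have h4 : ∑ i : Fin n, q i.succ ^ 2 = q 0 ^ 2 - 1 := by linarith
  rw [h3, h4] at hcs
  have h5 : (∑ i : Fin n, p i.succ * q i.succ) ^ 2 ≤ (p 0 * q 0 - 1) ^ 2 := by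
    nlinarith [sq_nonneg (p 0 - q 0)]
  have h6 := abs_le_of_sq_le_sq' h5 (by nlinarith)
  unfold lorentz
  linarith [h6.2]

theorem eq_of_lorentz_eq_neg_one {p q : Fin (n + 1) → ℝ} (hp : lorentz p p = -1)
    (hq : lorentz q q = -1) (h : lorentz p q = -1) : p = q := by
  refine sub_eq_zero.1 (eq_zero_of_orthogonal (p := q) ?_ hq ?_)
  · rw [lorentz_sub_left, h, hq, sub_self]
  · simp only [lorentz_sub_left, lorentz_sub_right, hp, hq, h, lorentz_comm q p]
    norm_num

end Lorentz

/-! ### The hyperboloid model -/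

section Hyperboloid

variable {n : ℕ}

theorem zero_ne_zero_of_lorentz_neg {v : Fin (n + 1) → ℝ} (h : lorentz v v < 0) : v 0 ≠ 0 := by
  intro h0
  rw [lorentz_self, h0] at h
  have : 0 ≤ ∑ i : Fin n, v i.succ ^ 2 := Finset.sum_nonneg fun i _ => sq_nonneg _
  linarith

theorem ne_zero_of_lorentz_neg {v : Fin (n + 1) → ℝ} (h : lorentz v v < 0) : v ≠ 0 := by
  rintro rfl
  exact zero_ne_zero_of_lorentz_neg h rfl

/-- The point of hyperbolic space represented by a negative vector. -/
def HypSpace.of (v : Fin (n + 1) → ℝ) (h : lorentz v v < 0) : HypSpace n :=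
  HypSpace.mk v (ne_zero_of_lorentz_neg h) h

theorem exists_unit_rep (p : HypSpace n) : ∃ (v : Fin (n + 1) → ℝ) (h : lorentz v v < 0),
    lorentz v v = -1 ∧ 0 < v 0 ∧ p = HypSpace.of v h := by
  obtain ⟨w, hw, h, rfl⟩ := p.exists_mk
  have hs : 0 < Real.sqrt (-lorentz w w) := Real.sqrt_pos.2 (by linarith)
  have hs2 : Real.sqrt (-lorentz w w) ^ 2 = -lorentz w w := Real.sq_sqrt (by linarith)
  have key : ∀ a : ℝ, a ^ 2 * -lorentz w w = 1 → 0 < a * w 0 →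
      ∃ (v : Fin (n + 1) → ℝ) (h : lorentz v v < 0),
        lorentz v v = -1 ∧ 0 < v 0 ∧ HypSpace.mk w hw ‹_› = HypSpace.of v h := by
    intro a ha ha0
    have h1 : lorentz (a • w) (a • w) = -1 := by rw [lorentz_smul]; linarith
    refine ⟨a • w, by rw [h1]; norm_num, h1, ha0, Subtype.ext ?_⟩
    change Projectivization.mk ℝ _ _ = Projectivization.mk ℝ _ _
    refine ((Projectivization.mk_eq_mk_iff' ℝ _ _ _ _).2 ⟨a, rfl⟩).symm
  rcases (zero_ne_zero_of_lorentz_neg h).lt_or_gt with h0 | h0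
  · refine key (-(Real.sqrt (-lorentz w w))⁻¹) ?_ ?_
    · rw [neg_sq, inv_pow, hs2, inv_mul_cancel₀ (by linarith)]
    · exact mul_pos_of_neg_of_neg (neg_lt_zero.2 (inv_pos.2 hs)) h0
  · refine key (Real.sqrt (-lorentz w w))⁻¹ ?_ ?_
    · rw [inv_pow, hs2, inv_mul_cancel₀ (by linarith)]
    · exact mul_pos (inv_pos.2 hs) h0

/-- The representative of a point of hyperbolic space on the upper sheet
`⟨v, v⟩ = -1`, `v⁰ > 0` of the hyperboloid. -/
def HypSpace.lift (p : HypSpace n) : Fin (n + 1) → ℝ := (exists_unit_rep p).choose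

theorem lift_self (p : HypSpace n) : lorentz p.lift p.lift = -1 :=
  (exists_unit_rep p).choose_spec.choose_spec.1

theorem lift_pos (p : HypSpace n) : 0 < p.lift 0 :=
  (exists_unit_rep p).choose_spec.choose_spec.2.1

theorem lift_neg (p : HypSpace n) : lorentz p.lift p.lift < 0 := by
  rw [lift_self]; norm_num

theorem of_lift (p : HypSpace n) : HypSpace.of p.lift (lift_neg p) = p :=
  (exists_unit_rep p).choose_spec.choose_spec.2.2.symm

theorem lift_injective : Function.Injective (HypSpace.lift (n := n)) := by
  intro p q h
  rw [← of_lift p, ← of_lift q]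
  congr 1

theorem exists_lift_of (v : Fin (n + 1) → ℝ) (h : lorentz v v < 0) :
    ∃ a : ℝ, a ≠ 0 ∧ (HypSpace.of v h).lift = a • v := by
  have h1 := congrArg Subtype.val (of_lift (HypSpace.of v h))
  obtain ⟨a, ha⟩ := (Projectivization.mk_eq_mk_iff' ℝ _ _ _ _).1 h1
  refine ⟨a, ?_, ha.symm⟩
  rintro rfl
  have := lift_self (HypSpace.of v h)
  rw [← ha] at this
  simp [lorentz] at this

theorem exists_lift_of_pos (v : Fin (n + 1) → ℝ) (h : lorentz v v < 0) (h0 : 0 < v 0) :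
    ∃ a : ℝ, 0 < a ∧ a ^ 2 * lorentz v v = -1 ∧ (HypSpace.of v h).lift = a • v := by
  obtain ⟨a, -, ha⟩ := exists_lift_of v h
  refine ⟨a, ?_, ?_, ha⟩
  · have := lift_pos (HypSpace.of v h)
    rw [ha] at this
    exact (pos_iff_pos_of_mul_pos this).2 h0
  · have := lift_self (HypSpace.of v h)
    rw [ha, lorentz_smul] at this
    rw [pow_two, this]

theorem lift_of (v : Fin (n + 1) → ℝ) (h : lorentz v v = -1) (h0 : 0 < v 0) :
    (HypSpace.of v (by rw [h]; norm_num)).lift = v := by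
  obtain ⟨a, ha, h1, h2⟩ := exists_lift_of_pos v (by rw [h]; norm_num) h0
  rw [h] at h1
  have : a = 1 := by nlinarith
  rw [h2, this, one_smul]

theorem lift_smul (g : lorentzGroup n) (p : HypSpace n) :
    ∃ a : ℝ, a ^ 2 = 1 ∧ (g • p).lift = a • (g.1 • p.lift) := by
  have h1 : g • p = HypSpace.of (g.1 • p.lift) (by rw [g.2]; exact lift_neg p) := by
    conv_lhs => rw [← of_lift p]
    rfl
  obtain ⟨a, -, ha⟩ := exists_lift_of (g.1 • p.lift) (by rw [g.2]; exact lift_neg p)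
  refine ⟨a, ?_, by rw [h1, ha]⟩
  have := lift_self (g • p)
  rw [h1, ha, lorentz_smul, g.2, lift_self] at this
  linarith

theorem smul_eq_of_smul_lift (g : lorentzGroup n) (p q : HypSpace n)
    (h : g.1 • p.lift = q.lift) : g • p = q := by
  conv_lhs => rw [← of_lift p]
  conv_rhs => rw [← of_lift q]
  refine Subtype.ext ?_
  change Projectivization.mk ℝ (g.1 • p.lift) _ = Projectivization.mk ℝ _ _
  simp only [h]

theorem lorentz_lift_le (p q : HypSpace n) : lorentz p.lift q.lift ≤ -1 :=
  lorentz_le_neg_one (lift_self p) (lift_self q) (lift_pos p) (lift_pos q)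

theorem hdist_eq (p q : HypSpace n) : hdist p q = Real.arcosh (-lorentz p.lift q.lift) := by
  conv_lhs => rw [← of_lift p, ← of_lift q]
  refine (hdist_mk _ _ _ _ _ _).trans ?_
  have := lorentz_lift_le p q
  rw [lift_self, lift_self, abs_of_neg (by linarith)]
  norm_num

theorem hdist_nonneg (p q : HypSpace n) : 0 ≤ hdist p q := by
  rw [hdist_eq]
  exact Real.arcosh_nonneg (by linarith [lorentz_lift_le p q])

theorem lorentz_lift (p q : HypSpace n) :
    lorentz p.lift q.lift = -Real.cosh (hdist p q) := by
  rw [hdist_eq, Real.cosh_arcosh (by linarith [lorentz_lift_le p q]), neg_neg]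

theorem hdist_eq_of_lorentz {p q : HypSpace n} {t : ℝ} (ht : 0 ≤ t)
    (h : lorentz p.lift q.lift = -Real.cosh t) : hdist p q = t := by
  rw [hdist_eq, h, neg_neg, Real.arcosh_cosh ht]

theorem hdist_comm (p q : HypSpace n) : hdist p q = hdist q p := by
  rw [hdist_eq, hdist_eq, lorentz_comm]

theorem hdist_self (p : HypSpace n) : hdist p p = 0 :=
  hdist_eq_of_lorentz le_rfl (by rw [lift_self, Real.cosh_zero])

theorem eq_of_hdist_eq_zero {p q : HypSpace n} (h : hdist p q = 0) : p = q :=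
  lift_injective (eq_of_lorentz_eq_neg_one (lift_self p) (lift_self q)
    (by rw [lorentz_lift, h, Real.cosh_zero]))

end Hyperboloid

/-! ### Reflections and transitivity -/

section Reflection

variable {n : ℕ}

/-- The matrix of the reflection `w ↦ w - 2 ⟨u, w⟩ / ⟨u, u⟩ u` in the hyperplane orthogonal to
`u`; since `x / 0 = 0`, it is the identity when `u` is isotropic. -/
def reflMatrix (u : Fin (n + 1) → ℝ) : Matrix (Fin (n + 1)) (Fin (n + 1)) ℝ :=
  Matrix.of fun i j => (1 : Matrix (Fin (n + 1)) (Fin (n + 1)) ℝ) i j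
    - 2 / lorentz u u * u i * lorentz u (Pi.single j 1)

theorem lorentz_eq_sum (u w : Fin (n + 1) → ℝ) :
    lorentz u w = ∑ j, lorentz u (Pi.single j 1) * w j := by
  have h : w = ∑ j, w j • (Pi.single j 1 : Fin (n + 1) → ℝ) := by
    funext i
    simp [Finset.sum_apply, Pi.single_apply]
  have h2 : ∀ s : Finset (Fin (n + 1)), lorentz u (∑ j ∈ s, w j • Pi.single j 1) =
      ∑ j ∈ s, lorentz u (Pi.single j 1) * w j := by
    intro s
    induction s using Finset.induction_on with
    | empty => simp [lorentz]
    | insert a s ha ih =>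
      rw [Finset.sum_insert ha, Finset.sum_insert ha, lorentz_add_right, ih, lorentz_smul_right,
        mul_comm]
  conv_lhs => rw [h]
  exact h2 _

theorem reflMatrix_mulVec (u w : Fin (n + 1) → ℝ) :
    reflMatrix u *ᵥ w = w - (2 / lorentz u u * lorentz u w) • u := by
  funext i
  simp only [Matrix.mulVec, dotProduct, reflMatrix, Matrix.of_apply, sub_mul,
    Finset.sum_sub_distrib, Pi.sub_apply, Pi.smul_apply, smul_eq_mul]
  congr 1
  · simp [Matrix.one_apply]
  · rw [lorentz_eq_sum u w, Finset.mul_sum, Finset.sum_mul]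
    exact Finset.sum_congr rfl fun j _ => by ring

theorem lorentz_reflMatrix (u z w : Fin (n + 1) → ℝ) :
    lorentz (reflMatrix u *ᵥ z) (reflMatrix u *ᵥ w) = lorentz z w := by
  simp only [reflMatrix_mulVec, lorentz_sub_left, lorentz_sub_right, lorentz_smul_left,
    lorentz_smul_right, lorentz_comm z u]
  by_cases h : lorentz u u = 0
  · simp [h]
  · field_simp
    ring

theorem reflMatrix_mul_self (u : Fin (n + 1) → ℝ) : reflMatrix u * reflMatrix u = 1 := by
  refine Matrix.ext_of_mulVec_single fun j => ?_
  rw [← Matrix.mulVec_mulVec, Matrix.one_mulVec]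
  simp only [reflMatrix_mulVec, lorentz_sub_right, lorentz_smul_right]
  by_cases h : lorentz u u = 0
  · simp [h]
  · rw [sub_sub, ← add_smul, sub_eq_self]
    convert zero_smul ℝ u
    field_simp
    ring

/-- The reflection in the hyperplane orthogonal to `u`, as an element of `O(1, n)`. -/
def refl (u : Fin (n + 1) → ℝ) : lorentzGroup n :=
  ⟨⟨reflMatrix u, reflMatrix u, reflMatrix_mul_self u, reflMatrix_mul_self u⟩,
    fun z w => lorentz_reflMatrix u z w⟩

theorem refl_smul (u w : Fin (n + 1) → ℝ) :
    (refl u).1 • w = w - (2 / lorentz u u * lorentz u w) • u :=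
  reflMatrix_mulVec u w

/-- Reflection in the bisector of two vectors of the same length exchanges them. -/
theorem refl_sub_smul {p q : Fin (n + 1) → ℝ} (h : lorentz p p = lorentz q q)
    (hpq : lorentz (p - q) (p - q) ≠ 0) : (refl (p - q)).1 • p = q := by
  have h1 : 2 * lorentz (p - q) p = lorentz (p - q) (p - q) := by
    simp only [lorentz_sub_left, lorentz_sub_right, lorentz_comm q p, h]
    ring
  have h2 : 2 / lorentz (p - q) (p - q) * lorentz (p - q) p = 1 := by
    rw [div_mul_eq_mul_div, h1, div_self hpq]
  rw [refl_smul, h2, one_smul, sub_sub_cancel]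

/-- Any two points are exchanged by an isometry that fixes all points equidistant to them. -/
theorem exists_smul_eq_of_bisector (p q : HypSpace n) :
    ∃ g : lorentzGroup n, g • p = q ∧ ∀ z, hdist z p = hdist z q → g • z = z := by
  by_cases hpq : p = q
  · exact ⟨1, by rw [one_smul, hpq], fun z _ => one_smul _ z⟩
  refine ⟨refl (p.lift - q.lift), smul_eq_of_smul_lift _ _ _ (refl_sub_smul ?_ ?_), ?_⟩
  · rw [lift_self, lift_self]
  · intro h
    refine hpq (lift_injective (eq_of_lorentz_eq_neg_one (lift_self p) (lift_self q) ?_))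
    simp only [lorentz_sub_left, lorentz_sub_right, lift_self, lorentz_comm q.lift] at h
    linarith
  · intro z hz
    refine smul_eq_of_smul_lift _ _ _ ?_
    have : lorentz (p.lift - q.lift) z.lift = 0 := by
      rw [lorentz_sub_left, lorentz_lift, lorentz_lift, hdist_comm p, hdist_comm q, hz, sub_self]
    rw [refl_smul, this, mul_zero, zero_smul, sub_zero]

/-- Hyperbolic space is two-point homogeneous. -/
theorem exists_smul_pair {x y x' y' : HypSpace n} (h : hdist x y = hdist x' y') :
    ∃ g : lorentzGroup n, g • x = x' ∧ g • y = y' := by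
  obtain ⟨g₁, h₁, -⟩ := exists_smul_eq_of_bisector x x'
  obtain ⟨g₂, h₂, h₃⟩ := exists_smul_eq_of_bisector (g₁ • y) y'
  refine ⟨g₂ * g₁, ?_, by rw [mul_smul, h₂]⟩
  rw [mul_smul, h₁, h₃]
  rw [← h, ← h₁, hdist_smul]

end Reflection

/-! ### Orthogonal hyperplanes -/

section Perp

variable {n : ℕ}

/-- The set of points of hyperbolic space orthogonal to the vector `w`; it is a hyperplane when
`w` is spacelike. -/
def perp (w : Fin (n + 1) → ℝ) : Set (HypSpace n) := {p | lorentz w p.lift = 0}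

theorem mem_perp {w : Fin (n + 1) → ℝ} {p : HypSpace n} :
    p ∈ perp w ↔ lorentz w p.lift = 0 := Iff.rfl

theorem perp_smul_of_ne_zero {a : ℝ} (ha : a ≠ 0) (w : Fin (n + 1) → ℝ) :
    perp (a • w) = perp w := by
  ext p
  simp [mem_perp, lorentz_smul_left, ha]

theorem perp_neg (w : Fin (n + 1) → ℝ) : perp (-w) = perp w := by
  simpa using perp_smul_of_ne_zero (a := -1) (by norm_num) w

theorem smul_mem_perp (g : lorentzGroup n) (w : Fin (n + 1) → ℝ) (p : HypSpace n) :
    g • p ∈ perp (g.1 • w) ↔ p ∈ perp w := by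
  obtain ⟨a, ha, h⟩ := lift_smul g p
  have ha0 : a ≠ 0 := by rintro rfl; norm_num at ha
  rw [mem_perp, mem_perp, h, lorentz_smul_right, g.2, mul_eq_zero, or_iff_right ha0]

theorem smul_perp (g : lorentzGroup n) (w : Fin (n + 1) → ℝ) :
    g • perp w = perp (g.1 • w) := by
  ext p
  rw [Set.mem_smul_set_iff_inv_smul_mem, ← smul_mem_perp g, smul_inv_smul]

theorem lorentz_single_zero (x : Fin (n + 1) → ℝ) : lorentz x (Pi.single 0 1) = -x 0 := by
  simp [lorentz, Fin.succ_ne_zero]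

theorem lorentz_single_succ (x : Fin (n + 1) → ℝ) (i : Fin n) :
    lorentz x (Pi.single i.succ 1) = x i.succ := by
  simp [lorentz, Pi.single_apply, (Fin.succ_ne_zero _).symm]

/-- The last vector of the standard basis, which is normal to the hyperplane `S₀`. -/
def lastVec (n : ℕ) : Fin (n + 2) → ℝ := Pi.single (Fin.last (n + 1)) 1

theorem lorentz_lastVec (w : Fin (n + 2) → ℝ) :
    lorentz (n := n + 1) (lastVec n) w = w (Fin.last (n + 1)) := by
  rw [lorentz_comm, lastVec, ← Fin.succ_last, lorentz_single_succ]

theorem lorentz_lastVec_self : lorentz (n := n + 1) (lastVec n) (lastVec n) = 1 := by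
  rw [lorentz_lastVec]
  simp [lastVec]

theorem stdSet_eq_perp : stdSet n = perp (lastVec n) := by
  ext p
  rw [mem_perp, lorentz_lastVec]
  obtain ⟨a, ha⟩ := Projectivization.exists_smul_eq_mk_rep ℝ p.lift
    (ne_zero_of_lorentz_neg (lift_neg p))
  have h1 : Projectivization.mk ℝ p.lift (ne_zero_of_lorentz_neg (lift_neg p)) = p.1 :=
    congrArg Subtype.val (of_lift p)
  rw [h1] at ha
  have h2 : p.1.rep (Fin.last (n + 1)) = a.1 * p.lift (Fin.last (n + 1)) := by
    rw [← ha]; rfl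
  change p.1.rep (Fin.last (n + 1)) = 0 ↔ _
  rw [h2, mul_eq_zero, or_iff_right a.ne_zero]

theorem smul_stdHyperplane_val (g : lorentzGroup (n + 1)) :
    (g • stdHyperplane n).1 = perp (g.1 • lastVec n) := by
  rw [← smul_perp, ← stdSet_eq_perp]
  rfl

/-- Either of the reflections exchanging `lastVec n` with `v` or with `-v` carries `S₀` to the
hyperplane orthogonal to the unit vector `v`. -/
theorem refl_sub_smul_stdHyperplane {v : Fin (n + 2) → ℝ} (hv : lorentz (n := n + 1) v v = 1)
    (h : lorentz (n := n + 1) (lastVec n - v) (lastVec n - v) ≠ 0) :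
    (refl (lastVec n - v) • stdHyperplane n).1 = perp v := by
  rw [smul_stdHyperplane_val, refl_sub_smul (by rw [hv, lorentz_lastVec_self]) h]

theorem refl_add_smul_stdHyperplane {v : Fin (n + 2) → ℝ} (hv : lorentz (n := n + 1) v v = 1)
    (h : lorentz (n := n + 1) (lastVec n + v) (lastVec n + v) ≠ 0) :
    (refl (lastVec n + v) • stdHyperplane n).1 = perp v := by
  have := refl_sub_smul_stdHyperplane (v := -v)
    (by rw [lorentz_neg_left, lorentz_neg_right, neg_neg, hv]) (by rwa [sub_neg_eq_add])
  rwa [sub_neg_eq_add, perp_neg] at this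

theorem lorentz_lastVec_sub_ne_zero_or {v : Fin (n + 2) → ℝ}
    (hv : lorentz (n := n + 1) v v = 1) :
    lorentz (n := n + 1) (lastVec n - v) (lastVec n - v) ≠ 0 ∨
      lorentz (n := n + 1) (lastVec n + v) (lastVec n + v) ≠ 0 := by
  by_contra! h
  simp only [lorentz_sub_left, lorentz_sub_right, lorentz_add_left, lorentz_add_right,
    lorentz_lastVec_self, hv, lorentz_comm v] at h
  linarith [h.1, h.2]

theorem isHyperplane_perp {w : Fin (n + 2) → ℝ} (hw : 0 < lorentz (n := n + 1) w w) :
    IsHyperplane (perp w) := by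
  have hs : 0 < Real.sqrt (lorentz (n := n + 1) w w) := Real.sqrt_pos.2 hw
  have hv : lorentz (n := n + 1) ((Real.sqrt (lorentz (n := n + 1) w w))⁻¹ • w)
      ((Real.sqrt (lorentz (n := n + 1) w w))⁻¹ • w) = 1 := by
    rw [lorentz_smul, ← mul_inv, Real.mul_self_sqrt hw.le, inv_mul_cancel₀ hw.ne']
  rw [← perp_smul_of_ne_zero (inv_ne_zero hs.ne') w]
  rcases lorentz_lastVec_sub_ne_zero_or hv with h | h
  · rw [← refl_sub_smul_stdHyperplane hv h]
    exact Subtype.property _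
  · rw [← refl_add_smul_stdHyperplane hv h]
    exact Subtype.property _

end Perp

/-! ### Every hyperplane is orthogonal to a unit spacelike vector -/

section Classification

variable {n : ℕ}

theorem lorentz_sum_right {ι : Type*} (s : Finset ι) (z : Fin (n + 1) → ℝ)
    (B : ι → Fin (n + 1) → ℝ) : lorentz z (∑ j ∈ s, B j) = ∑ j ∈ s, lorentz z (B j) := by
  classical
  induction s using Finset.induction_on with
  | empty => simp [lorentz]
  | insert a s ha ih => rw [Finset.sum_insert ha, Finset.sum_insert ha, lorentz_add_right, ih]

theorem eq_zero_of_lorentz_eq_zero {x : Fin (n + 1) → ℝ} (h : ∀ y, lorentz x y = 0) : x = 0 := by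
  funext i
  refine Fin.cases ?_ (fun j => ?_) i
  · have := h (Pi.single 0 1)
    rw [lorentz_single_zero] at this
    simpa using this
  · have := h (Pi.single j.succ 1)
    rwa [lorentz_single_succ] at this

/-- The point of hyperbolic space spanned by the time axis. -/
def origin (n : ℕ) : HypSpace n :=
  HypSpace.of (Pi.single 0 1) (by rw [lorentz_single_zero]; simp)

theorem origin_lift : (origin n).lift = Pi.single 0 1 :=
  lift_of _ (by rw [lorentz_single_zero]; simp) (by simp)

/-- Points of hyperbolic space span the ambient space. -/
theorem exists_lift_sub_eq_single (j : Fin (n + 1)) :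
    ∃ (c : HypSpace n) (r : ℝ), c.lift - r • (origin n).lift = Pi.single j 1 := by
  refine Fin.cases ⟨origin n, 0, ?_⟩ (fun i => ?_) j
  · rw [zero_smul, sub_zero, origin_lift]
  · set v : Fin (n + 1) → ℝ := Pi.single i.succ 1 + Real.sqrt 2 • Pi.single 0 1 with hv
    have h0 : v 0 = Real.sqrt 2 := by
      simp [hv, (Fin.succ_ne_zero _).symm]
    have h1 : v i.succ = 1 := by simp [hv, Fin.succ_ne_zero]
    have h2 : lorentz v v = -1 := by
      conv_lhs => rw [hv]
      rw [← hv, lorentz_add_left, lorentz_smul_left, lorentz_comm _ v, lorentz_comm _ v,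
        lorentz_single_succ, lorentz_single_zero, h0, h1, mul_neg, Real.mul_self_sqrt (by norm_num)]
      norm_num
    refine ⟨HypSpace.of v (by rw [h2]; norm_num), Real.sqrt 2, ?_⟩
    rw [lift_of v h2 (by rw [h0]; positivity), origin_lift, hv, add_sub_cancel_right]

/-- An isometric embedding of `Hⁿ` into `Hᵐ` is the restriction of a linear map preserving the
Lorentz forms. -/
theorem exists_linearMap_of_isometry {m : ℕ} {f : HypSpace n → HypSpace m}
    (hf : ∀ x y, hdist (f x) (f y) = hdist x y) :
    ∃ L : (Fin (n + 1) → ℝ) →ₗ[ℝ] (Fin (m + 1) → ℝ),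
      (∀ x y, lorentz (L x) (L y) = lorentz x y) ∧ ∀ p, (f p).lift = L p.lift := by
  -- The vectors `B j` are the images of the standard basis vectors, which are combinations of
  -- points. For each point `p`, the difference of `(f p).lift` and `L p.lift` is then isotropic and
  -- orthogonal to a timelike vector, so it vanishes.
  choose c r hc using exists_lift_sub_eq_single (n := n)
  set B : Fin (n + 1) → Fin (m + 1) → ℝ :=
    fun j => (f (c j)).lift - r j • (f (origin n)).lift with hB
  have hff : ∀ p q, lorentz (f p).lift (f q).lift = lorentz p.lift q.lift := fun p q => by
    rw [lorentz_lift, lorentz_lift, hf]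
  have h1 : ∀ p j, lorentz (f p).lift (B j) = lorentz p.lift (Pi.single j 1) := fun p j => by
    simp only [hB, ← hc j, lorentz_sub_right, lorentz_smul_right, hff]
  set L := Fintype.linearCombination ℝ B with hL
  have hLx : ∀ x, L x = ∑ j, x j • B j := fun x => rfl
  have h2 : ∀ p x, lorentz (f p).lift (L x) = lorentz p.lift x := fun p x => by
    rw [hLx, lorentz_sum_right, lorentz_eq_sum p.lift x]
    exact Finset.sum_congr rfl fun j _ => by rw [lorentz_smul_right, h1, mul_comm]
  have h3 : ∀ x y, lorentz (L x) (L y) = lorentz x y := fun x y => by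
    rw [lorentz_comm, hLx x, lorentz_sum_right, lorentz_comm x, lorentz_eq_sum y x]
    refine Finset.sum_congr rfl fun j _ => ?_
    rw [lorentz_smul_right, mul_comm, lorentz_comm _ (B j), lorentz_comm y, ← hc j]
    simp only [hB, lorentz_sub_left, lorentz_smul_left, h2]
  refine ⟨L, h3, fun p => sub_eq_zero.1 (eq_zero_of_orthogonal (p := (f (origin n)).lift) ?_
    (lift_self _) ?_)⟩
  · rw [lorentz_comm, lorentz_sub_right, hff, h2, lorentz_comm, sub_self]
  · simp only [lorentz_sub_left, lorentz_sub_right, h2, h3, lorentz_comm (L p.lift) (f p).lift,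
      lift_self]
    norm_num

theorem exists_eq_perp {S : Set (HypSpace (n + 1))} (hS : IsHyperplane S) :
    ∃ v : Fin (n + 2) → ℝ, lorentz (n := n + 1) v v = 1 ∧ S = perp v := by
  obtain ⟨f, hf, rfl⟩ := hS
  obtain ⟨L, hL, hfL⟩ := exists_linearMap_of_isometry hf
  -- A normal vector exists for reasons of dimension.
  obtain ⟨w, hw0, hw⟩ : ∃ w : Fin (n + 2) → ℝ, w ≠ 0 ∧
      ∀ x, lorentz (n := n + 1) w (L x) = 0 := by
    let T : (Fin (n + 2) → ℝ) →ₗ[ℝ] (Fin (n + 1) → ℝ) :=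
      { toFun := fun w j => lorentz (n := n + 1) w (L (Pi.single j 1))
        map_add' := fun a b => funext fun j => lorentz_add_left _ _ _
        map_smul' := fun a b => funext fun j => lorentz_smul_left _ _ _ }
    obtain ⟨w, hw, hw0⟩ := (Submodule.ne_bot_iff _).1
      (LinearMap.ker_ne_bot_of_finrank_lt (f := T) (by simp))
    refine ⟨w, hw0, fun x => ?_⟩
    have hx : x = ∑ j, x j • (Pi.single j 1 : Fin (n + 1) → ℝ) := by
      funext i
      simp [Finset.sum_apply, Pi.single_apply]
    rw [hx, map_sum, lorentz_sum_right]
    refine Finset.sum_eq_zero fun j _ => ?_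
    rw [map_smul, lorentz_smul_right, show lorentz (n := n + 1) w (L (Pi.single j 1)) = 0 from
      congrFun (LinearMap.mem_ker.1 hw) j, mul_zero]
  have hww : 0 < lorentz (n := n + 1) w w := by
    by_contra! h
    refine hw0 (eq_zero_of_orthogonal (p := (f (origin n)).lift) ?_ (lift_self _) h)
    rw [hfL, hw]
  have hs : 0 < Real.sqrt (lorentz (n := n + 1) w w) := Real.sqrt_pos.2 hww
  refine ⟨(Real.sqrt (lorentz (n := n + 1) w w))⁻¹ • w, ?_, ?_⟩
  · rw [lorentz_smul, ← mul_inv, Real.mul_self_sqrt hww.le, inv_mul_cancel₀ hww.ne']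
  rw [perp_smul_of_ne_zero (inv_ne_zero hs.ne')]
  refine Set.Subset.antisymm ?_ fun q hq => ?_
  · rintro _ ⟨p, rfl⟩
    rw [mem_perp, hfL, hw]
  -- The range of `L` and the normal vector together span the ambient space.
  let M : (Fin (n + 2) → ℝ) →ₗ[ℝ] (Fin (n + 2) → ℝ) :=
    L ∘ₗ LinearMap.funLeft ℝ ℝ Fin.castSucc + (LinearMap.proj (Fin.last (n + 1))).smulRight w
  have hM : ∀ z, M z = L (fun i => z i.castSucc) + z (Fin.last (n + 1)) • w := fun z => rfl
  have hinj : Function.Injective M := by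
    refine (injective_iff_map_eq_zero M).2 fun z hz => ?_
    have h1 : (fun i : Fin (n + 1) => z i.castSucc) = 0 := eq_zero_of_lorentz_eq_zero fun y => by
      have := congrArg (lorentz (n := n + 1) · (L y)) hz
      simp only [hM, lorentz_add_left, lorentz_smul_left, hL, hw, mul_zero, add_zero] at this
      rw [this]
      simp [lorentz]
    have h2 : z (Fin.last (n + 1)) = 0 := by
      rw [hM, h1, map_zero, zero_add] at hz
      exact (smul_eq_zero.1 hz).resolve_right hw0
    funext i
    refine Fin.lastCases h2 (fun j => ?_) i
    exact congrFun h1 j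
  obtain ⟨z, hz⟩ := (LinearMap.injective_iff_surjective.1 hinj) q.lift
  set x : Fin (n + 1) → ℝ := fun i => z i.castSucc with hx
  have hq' : q.lift = L x := by
    rw [mem_perp, ← hz, hM, lorentz_add_right, hw, lorentz_smul_right, zero_add] at hq
    rw [← hz, hM, (mul_eq_zero.1 hq).resolve_right hww.ne', zero_smul, add_zero]
  have hxx : lorentz x x < 0 := by
    rw [← hL, ← hq']
    exact lift_neg q
  obtain ⟨a, -, ha⟩ := exists_lift_of x hxx
  refine ⟨HypSpace.of x hxx, lift_injective ?_⟩
  have h1 : (f (HypSpace.of x hxx)).lift = a • q.lift := by rw [hfL, ha, map_smul, hq']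
  have h2 := lift_self (f (HypSpace.of x hxx))
  rw [h1, lorentz_smul, lift_self] at h2
  have h3 : 0 < a := by
    have := lift_pos (f (HypSpace.of x hxx))
    rw [h1] at this
    exact (pos_iff_pos_of_mul_pos this).2 (lift_pos q)
  have h4 : a = 1 := by nlinarith
  rw [h1, h4, one_smul]

end Classification

/-! ### Geodesic segments -/

section Segment

variable {n : ℕ}

theorem sinh_identity (d s t : ℝ) :
    Real.sinh (d - s) * Real.sinh (d - t) + Real.sinh s * Real.sinh t
      + (Real.sinh (d - s) * Real.sinh t + Real.sinh s * Real.sinh (d - t)) * Real.cosh d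
      = Real.sinh d ^ 2 * Real.cosh (s - t) := by
  rw [Real.sinh_sub, Real.sinh_sub, Real.cosh_sub]
  linear_combination (-Real.sinh s * Real.sinh t) * Real.cosh_sq_sub_sinh_sq d

/-- The point at distance `t` from `x` on the geodesic from `x` to `y`, on the hyperboloid. -/
def geoVec (x y : HypSpace n) (t : ℝ) : Fin (n + 1) → ℝ :=
  (Real.sinh (hdist x y - t) / Real.sinh (hdist x y)) • x.lift +
    (Real.sinh t / Real.sinh (hdist x y)) • y.lift

theorem lorentz_geoVec {x y : HypSpace n} (h : 0 < hdist x y) (s t : ℝ) :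
    lorentz (geoVec x y s) (geoVec x y t) = -Real.cosh (s - t) := by
  have hs : Real.sinh (hdist x y) ≠ 0 := (Real.sinh_pos_iff.2 h).ne'
  simp only [geoVec, lorentz_add_left, lorentz_add_right, lorentz_smul_left, lorentz_smul_right,
    lift_self, lorentz_comm y.lift x.lift, lorentz_lift x y]
  have := sinh_identity (hdist x y) s t
  field_simp
  linear_combination -this

theorem geoVec_zero {x y : HypSpace n} (h : 0 < hdist x y) : geoVec x y 0 = x.lift := by
  have hs : Real.sinh (hdist x y) ≠ 0 := (Real.sinh_pos_iff.2 h).ne'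
  simp [geoVec, hs]

theorem geoVec_hdist {x y : HypSpace n} (h : 0 < hdist x y) :
    geoVec x y (hdist x y) = y.lift := by
  have hs : Real.sinh (hdist x y) ≠ 0 := (Real.sinh_pos_iff.2 h).ne'
  simp [geoVec, hs]

theorem geoVec_coeff {d t : ℝ} (h : 0 < d) (ht : t ∈ Icc 0 d) :
    Real.sinh t / Real.sinh d ∈ Icc (0 : ℝ) 1 := by
  have hs : 0 < Real.sinh d := Real.sinh_pos_iff.2 h
  exact ⟨div_nonneg (Real.sinh_nonneg_iff.2 ht.1) hs.le,
    (div_le_one hs).2 (Real.sinh_le_sinh.2 ht.2)⟩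

theorem geoVec_coeff' {d t : ℝ} (h : 0 < d) (ht : t ∈ Icc 0 d) :
    Real.sinh (d - t) / Real.sinh d ∈ Icc (0 : ℝ) 1 :=
  geoVec_coeff h ⟨by linarith [ht.2], by linarith [ht.1]⟩

theorem geoVec_zero_mem {x y : HypSpace n} (h : 0 < hdist x y) {t : ℝ}
    (ht : t ∈ Icc 0 (hdist x y)) : 0 < geoVec x y t 0 ∧ geoVec x y t 0 ≤ x.lift 0 + y.lift 0 := by
  have h1 := geoVec_coeff h ht
  have h2 := geoVec_coeff' h ht
  have hx := lift_pos x
  have hy := lift_pos y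
  have h3 : geoVec x y t 0 = Real.sinh (hdist x y - t) / Real.sinh (hdist x y) * x.lift 0 +
    Real.sinh t / Real.sinh (hdist x y) * y.lift 0 := rfl
  constructor
  · refine lt_of_le_of_ne ?_ fun h0 => ?_
    · rw [h3]
      exact add_nonneg (mul_nonneg h2.1 hx.le) (mul_nonneg h1.1 hy.le)
    · refine zero_ne_zero_of_lorentz_neg ?_ h0.symm
      rw [lorentz_geoVec h, sub_self, Real.cosh_zero]
      norm_num
  · rw [h3]
    nlinarith [h1.2, h2.2]

theorem mem_geodesicSegment_iff {x y : HypSpace n} (h : 0 < hdist x y) (z : HypSpace n) :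
    z ∈ geodesicSegment x y ↔ ∃ t ∈ Icc 0 (hdist x y), z.lift = geoVec x y t := by
  constructor
  · rintro ⟨γ, h0, h1, hγ, t, ht, rfl⟩
    refine ⟨t, ht, ?_⟩
    -- The distances to `x` and `y` determine the product of `(γ t).lift` with `geoVec x y t`.
    have hs : Real.sinh (hdist x y) ≠ 0 := (Real.sinh_pos_iff.2 h).ne'
    have hx : lorentz x.lift (γ t).lift = -Real.cosh t := by
      rw [lorentz_lift, ← h0, hγ 0 ⟨le_rfl, h.le⟩ t ht, zero_sub, abs_neg, Real.cosh_abs]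
    have hy : lorentz y.lift (γ t).lift = -Real.cosh (hdist x y - t) := by
      rw [lorentz_lift]
      conv_lhs => rw [← h1]
      rw [hγ _ ⟨h.le, le_rfl⟩ t ht, Real.cosh_abs]
    refine eq_of_lorentz_eq_neg_one (lift_self _) ?_ ?_
    · rw [lorentz_geoVec h, sub_self, Real.cosh_zero]
    · rw [lorentz_comm]
      simp only [geoVec, lorentz_add_left, lorentz_smul_left, hx, hy]
      field_simp
      rw [Real.sinh_sub, Real.cosh_sub]
      linear_combination -Real.sinh (hdist x y) * Real.cosh_sq_sub_sinh_sq t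
  · rintro ⟨t, ht, hz⟩
    have hneg : ∀ s, lorentz (geoVec x y s) (geoVec x y s) = -1 := fun s => by
      rw [lorentz_geoVec h, sub_self, Real.cosh_zero]
    have hl : ∀ s ∈ Icc 0 (hdist x y),
        (HypSpace.of (geoVec x y s) (by rw [hneg]; norm_num)).lift = geoVec x y s :=
      fun s hs => lift_of _ (hneg s) (geoVec_zero_mem h hs).1
    refine ⟨fun s => HypSpace.of (geoVec x y s) (by rw [hneg]; norm_num), lift_injective ?_,
      lift_injective ?_, fun s hs t ht => ?_, t, ht, lift_injective ?_⟩
    · rw [hl _ ⟨le_rfl, h.le⟩, geoVec_zero h]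
    · rw [hl _ ⟨h.le, le_rfl⟩, geoVec_hdist h]
    · refine hdist_eq_of_lorentz (abs_nonneg _) ?_
      rw [hl s hs, hl t ht, lorentz_geoVec h, Real.cosh_abs]
    · rw [hl t ht, hz]

theorem geodesicSegment_self (x : HypSpace n) : geodesicSegment x x = {x} := by
  ext z
  constructor
  · rintro ⟨γ, h0, -, -, t, ht, rfl⟩
    rw [hdist_self] at ht
    rw [mem_singleton_iff, ← h0, le_antisymm ht.2 ht.1]
  · rintro rfl
    refine ⟨fun _ => z, rfl, rfl, fun s hs t ht => ?_, 0, ⟨le_rfl, hdist_nonneg _ _⟩, rfl⟩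
    rw [hdist_self] at hs ht ⊢
    rw [le_antisymm hs.2 hs.1, le_antisymm ht.2 ht.1, sub_zero, abs_zero]

theorem lift_zero_le_of_mem_geodesicSegment {x y z : HypSpace n} (hz : z ∈ geodesicSegment x y) :
    z.lift 0 ≤ x.lift 0 + y.lift 0 := by
  rcases (hdist_nonneg x y).eq_or_lt' with h | h
  · obtain rfl := eq_of_hdist_eq_zero h
    rw [geodesicSegment_self, mem_singleton_iff] at hz
    rw [hz]
    linarith [lift_pos x]
  · obtain ⟨t, ht, hzt⟩ := (mem_geodesicSegment_iff h z).1 hz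
    rw [hzt]
    exact (geoVec_zero_mem h ht).2

/-- A hyperplane meets a segment if and only if its end points do not lie strictly on the same
side of the hyperplane. -/
theorem perp_inter_geodesicSegment_nonempty_iff (v : Fin (n + 1) → ℝ) (x y : HypSpace n) :
    (perp v ∩ geodesicSegment x y).Nonempty ↔ lorentz v x.lift * lorentz v y.lift ≤ 0 := by
  rcases (hdist_nonneg x y).eq_or_lt' with h | h
  · obtain rfl := eq_of_hdist_eq_zero h
    rw [geodesicSegment_self, Set.inter_singleton_nonempty, mem_perp]
    constructor
    · intro h; rw [h]; simp
    · intro h; exact mul_self_eq_zero.1 (le_antisymm h (mul_self_nonneg _))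
  have hs : 0 < Real.sinh (hdist x y) := Real.sinh_pos_iff.2 h
  have hgeo : ∀ t, lorentz v (geoVec x y t) =
      Real.sinh (hdist x y - t) / Real.sinh (hdist x y) * lorentz v x.lift +
        Real.sinh t / Real.sinh (hdist x y) * lorentz v y.lift := fun t => by
    simp only [geoVec, lorentz_add_right, lorentz_smul_right]
  constructor
  · rintro ⟨z, hz, hzs⟩
    obtain ⟨t, ht, hzt⟩ := (mem_geodesicSegment_iff h z).1 hzs
    rw [mem_perp, hzt, hgeo] at hz
    have h1 := (geoVec_coeff h ht).1
    have h2 := (geoVec_coeff' h ht).1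
    by_contra! hpos
    have h3 : Real.sinh (hdist x y - t) / Real.sinh (hdist x y) *
        (lorentz v x.lift * lorentz v y.lift) +
        Real.sinh t / Real.sinh (hdist x y) * lorentz v y.lift ^ 2 = 0 := by
      linear_combination lorentz v y.lift * hz
    have hy : 0 < lorentz v y.lift ^ 2 := by
      refine sq_pos_iff.2 ?_
      intro h0
      rw [h0, mul_zero] at hpos
      exact lt_irrefl _ hpos
    have h4 := mul_nonneg h2 hpos.le
    have h5 := mul_nonneg h1 hy.le
    have h6 : Real.sinh t / Real.sinh (hdist x y) = 0 :=
      (mul_eq_zero.1 (by linarith : Real.sinh t / Real.sinh (hdist x y) *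
        lorentz v y.lift ^ 2 = 0)).resolve_right hy.ne'
    have h7 : Real.sinh (hdist x y - t) / Real.sinh (hdist x y) = 0 :=
      (mul_eq_zero.1 (by linarith : Real.sinh (hdist x y - t) / Real.sinh (hdist x y) *
        (lorentz v x.lift * lorentz v y.lift) = 0)).resolve_right hpos.ne'
    rw [div_eq_zero_iff, or_iff_left hs.ne', Real.sinh_eq_zero] at h6 h7
    linarith
  · intro hxy
    have hcont : ContinuousOn (fun t => lorentz v (geoVec x y t)) (Icc 0 (hdist x y)) := by
      refine Continuous.continuousOn (continuous_const.lorentz ?_)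
      unfold geoVec
      have := Real.continuous_sinh
      fun_prop
    have h0 : lorentz v (geoVec x y 0) = lorentz v x.lift := by rw [geoVec_zero h]
    have h1 : lorentz v (geoVec x y (hdist x y)) = lorentz v y.lift := by rw [geoVec_hdist h]
    obtain ⟨t, ht, hvt⟩ : ∃ t ∈ Icc 0 (hdist x y), lorentz v (geoVec x y t) = 0 := by
      rcases le_total (lorentz v x.lift) 0 with hx | hx
      · rcases hx.eq_or_lt with hx | hx
        · exact ⟨0, ⟨le_rfl, h.le⟩, h0.trans hx⟩
        · exact intermediate_value_Icc h.le hcont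
            ⟨h0.trans_le hx.le, by rw [h1]; exact nonneg_of_mul_nonpos_right hxy hx⟩
      · rcases hx.eq_or_lt with hx | hx
        · exact ⟨0, ⟨le_rfl, h.le⟩, h0.trans hx.symm⟩
        · exact intermediate_value_Icc' h.le hcont
            ⟨by rw [h1]; exact nonpos_of_mul_nonpos_right hxy hx, h0.ge.trans' hx.le⟩
    have hneg : lorentz (geoVec x y t) (geoVec x y t) = -1 := by
      rw [lorentz_geoVec h, sub_self, Real.cosh_zero]
    have hl := lift_of _ hneg (geoVec_zero_mem h ht).1
    exact ⟨_, by rw [mem_perp, hl, hvt], (mem_geodesicSegment_iff h _).2 ⟨t, ht, hl⟩⟩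

end Segment

/-! ### The topology of the space of hyperplanes -/

section Topology

variable {n : ℕ}

theorem continuous_smul_vec (w : Fin (n + 1) → ℝ) :
    Continuous fun g : lorentzGroup n => g.1 • w := by
  change Continuous fun g : lorentzGroup n => (g.1.1 : Matrix (Fin (n + 1)) (Fin (n + 1)) ℝ) *ᵥ w
  exact (Units.continuous_val.comp continuous_subtype_val).matrix_mulVec continuous_const

theorem continuousAt_refl {u : Fin (n + 1) → ℝ} (hu : lorentz u u ≠ 0) :
    ContinuousAt refl u := by
  have hM : ContinuousAt (reflMatrix (n := n)) u := by
    refine continuousAt_pi.2 fun i => continuousAt_pi.2 fun j => ?_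
    simp only [reflMatrix, Matrix.of_apply]
    have h1 : ContinuousAt (fun u : Fin (n + 1) → ℝ => lorentz u u) u :=
      (continuous_id.lorentz continuous_id).continuousAt
    have h2 : ContinuousAt (fun u : Fin (n + 1) → ℝ => lorentz u (Pi.single j 1)) u :=
      (continuous_id.lorentz continuous_const).continuousAt
    exact continuousAt_const.sub
      (((continuousAt_const.div h1 hu).mul (continuous_apply i).continuousAt).mul h2)
  rw [Topology.IsInducing.subtypeVal.continuousAt_iff,
    Units.isInducing_embedProduct.continuousAt_iff]
  exact hM.prodMk (MulOpposite.continuous_op.continuousAt.comp hM)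

theorem continuous_orbit :
    Continuous fun g : lorentzGroup (n + 1) => g • stdHyperplane n :=
  continuous_coinduced_rng

theorem continuous_smul_hyperplane (g : lorentzGroup (n + 1)) :
    Continuous fun S : Hyperplane n => g • S := by
  refine continuous_coinduced_dom.2 ?_
  have : ((fun S : Hyperplane n => g • S) ∘ fun h : lorentzGroup (n + 1) => h • stdHyperplane n) =
      (fun h : lorentzGroup (n + 1) => h • stdHyperplane n) ∘ fun h => g * h := by
    funext h
    exact (mul_smul _ _ _).symm
  rw [this]
  exact continuous_orbit.comp (continuous_const_mul g)

/-- The hyperplane orthogonal to a spacelike vector. -/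
def perpHyperplane (w : Fin (n + 2) → ℝ) (h : 0 < lorentz (n := n + 1) w w) : Hyperplane n :=
  ⟨perp w, isHyperplane_perp h⟩

/-- The hyperplane with normal vector `w`, for `w` spacelike. The value at other vectors is the
arbitrary choice `S₀`. -/
def normalMap (w : Fin (n + 2) → ℝ) : Hyperplane n :=
  open Classical in
  if h : 0 < lorentz (n := n + 1) w w then perpHyperplane w h else stdHyperplane n

theorem normalMap_val {w : Fin (n + 2) → ℝ} (h : 0 < lorentz (n := n + 1) w w) :
    (normalMap w).1 = perp w := by
  rw [normalMap, dif_pos h]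
  rfl

theorem exists_normalMap_eq (S : Hyperplane n) :
    ∃ v : Fin (n + 2) → ℝ, lorentz (n := n + 1) v v = 1 ∧ S.1 = perp v ∧ normalMap v = S := by
  obtain ⟨v, hv, h⟩ := exists_eq_perp S.2
  exact ⟨v, hv, h, Subtype.ext (by rw [normalMap_val (by rw [hv]; norm_num), h])⟩

theorem normalMap_smul (g : lorentzGroup (n + 1)) {w : Fin (n + 2) → ℝ}
    (h : 0 < lorentz (n := n + 1) w w) : normalMap (g.1 • w) = g • normalMap w := by
  refine Subtype.ext ?_
  rw [normalMap_val (by rwa [g.2]), ← smul_perp, ← normalMap_val h]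
  rfl

theorem isOpen_spacelike : IsOpen {w : Fin (n + 1) → ℝ | 0 < lorentz w w} :=
  isOpen_lt continuous_const (continuous_id.lorentz continuous_id)

/-- The normalized reflections give local sections of the orbit map, which is why a hyperplane
depends continuously on its normal vector. -/
theorem continuousOn_normalMap :
    ContinuousOn (normalMap (n := n)) {w | 0 < lorentz (n := n + 1) w w} := by
  intro w₀ hw₀
  refine ContinuousAt.continuousWithinAt ?_
  set N : (Fin (n + 2) → ℝ) → Fin (n + 2) → ℝ :=
    fun w => (Real.sqrt (lorentz (n := n + 1) w w))⁻¹ • w with hN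
  have hunit : ∀ w, 0 < lorentz (n := n + 1) w w → lorentz (n := n + 1) (N w) (N w) = 1 := by
    intro w hw
    rw [hN, lorentz_smul, ← mul_inv, Real.mul_self_sqrt hw.le, inv_mul_cancel₀ hw.ne']
  have hperp : ∀ w, 0 < lorentz (n := n + 1) w w → perp (N w) = perp w := fun w hw =>
    perp_smul_of_ne_zero (inv_ne_zero (Real.sqrt_pos.2 hw).ne') w
  have hNc : ContinuousAt N w₀ := by
    have h1 : ContinuousAt (fun w => Real.sqrt (lorentz (n := n + 1) w w)) w₀ :=
      (Real.continuous_sqrt.comp (continuous_id.lorentz continuous_id)).continuousAt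
    exact (h1.inv₀ (Real.sqrt_pos.2 hw₀).ne').smul continuousAt_id
  have hW : ∀ᶠ w in nhds w₀, 0 < lorentz (n := n + 1) w w := isOpen_spacelike.mem_nhds hw₀
  have key : ∀ c : (Fin (n + 2) → ℝ) → Fin (n + 2) → ℝ, ContinuousAt c w₀ →
      lorentz (n := n + 1) (c w₀) (c w₀) ≠ 0 →
      (∀ w, 0 < lorentz (n := n + 1) w w → lorentz (n := n + 1) (c w) (c w) ≠ 0 →
        (refl (c w) • stdHyperplane n).1 = perp (N w)) → ContinuousAt (normalMap (n := n)) w₀ := by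
    intro c hc hc0 hcN
    have h1 : ContinuousAt (fun w => refl (c w) • stdHyperplane n) w₀ :=
      continuous_orbit.continuousAt.comp
        (ContinuousAt.comp (g := refl) (f := c) (continuousAt_refl hc0) hc)
    refine h1.congr ?_
    have h2 : ContinuousAt (fun w => lorentz (n := n + 1) (c w) (c w)) w₀ :=
      ContinuousAt.comp (g := fun u => lorentz (n := n + 1) u u) (f := c)
        (continuous_id.lorentz continuous_id).continuousAt hc
    filter_upwards [hW, h2.eventually_ne hc0] with w hw hcw
    refine Subtype.ext ?_
    rw [hcN w hw hcw, hperp w hw, normalMap_val hw]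
  -- Near `w₀`, one of the reflections exchanging `lastVec n` with `N w` or with `-N w` is defined.
  rcases lorentz_lastVec_sub_ne_zero_or (hunit w₀ hw₀) with h | h
  · exact key (fun w => lastVec n - N w) (continuousAt_const.sub hNc) h
      fun w hw hcw => refl_sub_smul_stdHyperplane (hunit w hw) hcw
  · exact key (fun w => lastVec n + N w) (continuousAt_const.add hNc) h
      fun w hw hcw => refl_add_smul_stdHyperplane (hunit w hw) hcw

theorem measurable_normalMap : Measurable (normalMap (n := n)) := by
  classical
  -- The map is continuous on the open set of spacelike vectors and constant off it.
  have h := ContinuousOn.measurable_piecewise (continuousOn_normalMap (n := n))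
    (g := normalMap) ?_ isOpen_spacelike.measurableSet
  · rwa [Set.piecewise_same] at h
  · refine (continuousOn_const (c := stdHyperplane n)).congr fun w hw => ?_
    exact dif_neg hw

/-- The set of hyperplanes that meet the segment `[xy]`. -/
def meeting (x y : HypSpace (n + 1)) : Set (Hyperplane n) :=
  {S | (S.1 ∩ geodesicSegment x y).Nonempty}

theorem mem_meeting_iff {S : Hyperplane n} {v : Fin (n + 2) → ℝ} (h : S.1 = perp v)
    (x y : HypSpace (n + 1)) :
    S ∈ meeting x y ↔ lorentz (n := n + 1) v x.lift * lorentz (n := n + 1) v y.lift ≤ 0 := by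
  rw [← perp_inter_geodesicSegment_nonempty_iff, ← h]
  rfl

theorem isClosed_meeting (x y : HypSpace (n + 1)) : IsClosed (meeting (n := n) x y) := by
  refine isClosed_coinduced.2 ?_
  have : (fun g : lorentzGroup (n + 1) => g • stdHyperplane n) ⁻¹' meeting x y =
      {g | lorentz (n := n + 1) (g.1 • lastVec n) x.lift *
        lorentz (n := n + 1) (g.1 • lastVec n) y.lift ≤ 0} := by
    ext g
    exact mem_meeting_iff (smul_stdHyperplane_val g) x y
  rw [this]
  exact isClosed_le (((continuous_smul_vec _).lorentz continuous_const).mul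
    ((continuous_smul_vec _).lorentz continuous_const)) continuous_const

theorem measurableSet_meeting (x y : HypSpace (n + 1)) :
    MeasurableSet (meeting (n := n) x y) :=
  (isClosed_meeting x y).measurableSet

theorem smul_mem_geodesicSegment (g : lorentzGroup n) {x y z : HypSpace n}
    (hz : z ∈ geodesicSegment x y) : g • z ∈ geodesicSegment (g • x) (g • y) := by
  obtain ⟨γ, h0, h1, hγ, t, ht, rfl⟩ := hz
  refine ⟨fun t => g • γ t, congrArg (g • ·) h0, ?_, ?_, t, ?_, rfl⟩
  · rw [hdist_smul]
    exact congrArg (g • ·) h1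
  · rw [hdist_smul]
    intro s hs t ht
    rw [hdist_smul, hγ s hs t ht]
  · rwa [hdist_smul]

theorem smul_mem_meeting (g : lorentzGroup (n + 1)) {S : Hyperplane n} {x y : HypSpace (n + 1)}
    (h : S ∈ meeting x y) : g • S ∈ meeting (g • x) (g • y) := by
  obtain ⟨z, hz, hz'⟩ := h
  exact ⟨g • z, Set.smul_mem_smul_set hz, smul_mem_geodesicSegment g hz'⟩

theorem image_smul_meeting (g : lorentzGroup (n + 1)) (x y : HypSpace (n + 1)) :
    (fun S : Hyperplane n => g • S) '' meeting x y = meeting (g • x) (g • y) := by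
  ext S
  constructor
  · rintro ⟨T, hT, rfl⟩
    exact smul_mem_meeting g hT
  · intro h
    refine ⟨g⁻¹ • S, ?_, smul_inv_smul g S⟩
    simpa using smul_mem_meeting g⁻¹ h

theorem norm_le_of_lorentz_le {w : Fin (n + 1) → ℝ} {R : ℝ} (h : lorentz w w ≤ 1)
    (hR : |w 0| ≤ R) : ‖w‖ ≤ R + 1 := by
  have hR0 : 0 ≤ R := (abs_nonneg _).trans hR
  have h0 : w 0 ^ 2 ≤ R ^ 2 := sq_le_sq' (abs_le.1 hR).1 (abs_le.1 hR).2
  refine (pi_norm_le_iff_of_nonneg (by linarith)).2 fun i => ?_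
  refine Fin.cases ?_ (fun j => ?_) i
  · rw [Real.norm_eq_abs]
    linarith
  · rw [Real.norm_eq_abs]
    refine abs_le_of_sq_le_sq ?_ (by linarith)
    have h1 : w j.succ ^ 2 ≤ ∑ i : Fin n, w i.succ ^ 2 :=
      Finset.single_le_sum (f := fun i : Fin n => w i.succ ^ 2) (fun i _ => sq_nonneg _)
        (Finset.mem_univ j)
    rw [lorentz_self] at h
    nlinarith

/-- The hyperplanes having a unit normal vector with time coordinate at most `R` in absolute
value. -/
def normalBall (n : ℕ) (R : ℝ) : Set (Hyperplane n) :=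
  normalMap '' {v | lorentz (n := n + 1) v v = 1 ∧ |v 0| ≤ R}

theorem isCompact_normalBall (R : ℝ) : IsCompact (normalBall n R) := by
  refine IsCompact.image_of_continuousOn ?_ (continuousOn_normalMap.mono fun v hv => ?_)
  · refine Metric.isCompact_of_isClosed_isBounded ?_ ?_
    · exact (isClosed_eq (continuous_id.lorentz continuous_id) continuous_const).inter
        (isClosed_le (continuous_abs.comp (continuous_apply 0)) continuous_const)
    · refine (Metric.isBounded_closedBall (x := 0) (r := R + 1)).subset fun v hv => ?_
      rw [mem_closedBall_zero_iff]
      exact norm_le_of_lorentz_le hv.1.le hv.2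
  · change 0 < lorentz (n := n + 1) v v
    rw [hv.1]
    norm_num

/-- A hyperplane that passes near the origin has a unit normal vector with small time
coordinate. -/
theorem mem_normalBall {S : Hyperplane n} {p : HypSpace (n + 1)} (hp : p ∈ S.1) {R : ℝ}
    (hR : p.lift 0 ≤ R) : S ∈ normalBall n R := by
  obtain ⟨v, hv, hS, rfl⟩ := exists_normalMap_eq S
  rw [hS] at hp
  refine ⟨v, ⟨hv, ?_⟩, rfl⟩
  have h := sq_zero_le_of_orthogonal hp (lift_self p)
  have := lift_pos p
  refine abs_le_of_sq_le_sq ?_ (by linarith)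
  rw [hv, mul_one] at h
  nlinarith

theorem meeting_subset_normalBall (x y : HypSpace (n + 1)) :
    meeting x y ⊆ normalBall n (x.lift 0 + y.lift 0) := by
  rintro S ⟨p, hp, hps⟩
  exact mem_normalBall hp (lift_zero_le_of_mem_geodesicSegment hps)

end Topology

/-! ### Points in general position -/

section Moment

variable {n : ℕ}

/-- The moment curve, with a time coordinate large enough to make it timelike on `[0, 1]`. -/
def momentVec (n : ℕ) (t : ℝ) : Fin (n + 2) → ℝ :=
  Fin.cons (n + 2 : ℝ) fun i : Fin (n + 1) => t ^ (i.1 + 1)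

theorem lorentz_momentVec_le {t : ℝ} (h0 : 0 ≤ t) (h1 : t ≤ 1) :
    lorentz (n := n + 1) (momentVec n t) (momentVec n t) ≤ -1 := by
  have h : ∑ i : Fin (n + 1), (momentVec n t) i.succ ^ 2 ≤ ∑ i : Fin (n + 1), (1 : ℝ) := by
    refine Finset.sum_le_sum fun i _ => ?_
    simp only [momentVec, Fin.cons_succ]
    exact pow_le_one₀ (by positivity) (pow_le_one₀ h0 h1)
  rw [lorentz_self]
  have h2 : momentVec n t 0 = n + 2 := rfl
  simp only [Finset.sum_const, Finset.card_univ, Fintype.card_fin, nsmul_eq_mul, mul_one,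
    Nat.cast_add, Nat.cast_one] at h
  rw [h2]
  nlinarith [(Nat.cast_nonneg n : (0 : ℝ) ≤ n)]

/-- A hyperplane meets the moment curve in finitely many points. -/
theorem finite_lorentz_momentVec_eq_zero {v : Fin (n + 2) → ℝ} (hv : v ≠ 0) :
    {t : ℝ | lorentz (n := n + 1) v (momentVec n t) = 0}.Finite := by
  -- The form evaluated along the curve is a polynomial whose coefficients are, up to nonzero
  -- factors, the coordinates of `v`.
  open Polynomial in
  set q : ℝ[X] := C (-(v 0 * (n + 2))) + ∑ i : Fin (n + 1), C (v i.succ) * X ^ (i.1 + 1) with hq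
  have hq0 : q ≠ 0 := by
    intro h
    refine hv (funext fun i => Fin.cases ?_ (fun j => ?_) i)
    · have h1 := congrArg (Polynomial.coeff · 0) h
      simp [hq, Polynomial.coeff_X_pow] at h1
      exact h1.resolve_right (by positivity)
    · have h1 := congrArg (Polynomial.coeff · (j.1 + 1)) h
      simpa [hq, Polynomial.coeff_X_pow, Polynomial.coeff_C, Fin.val_inj] using h1
  refine (q.rootSet_finite ℝ).subset fun t ht => ?_
  rw [Polynomial.mem_rootSet]
  refine ⟨hq0, ?_⟩
  have : lorentz (n := n + 1) v (momentVec n t) = 0 := ht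
  rw [← this]
  simp [hq, lorentz, momentVec, Polynomial.eval_finsetSum]

/-- Infinitely many points in a bounded part of hyperbolic space, of which each hyperplane
contains finitely many. -/
theorem exists_seq_finite_mem (n : ℕ) : ∃ (p : ℕ → HypSpace (n + 1)) (R : ℝ),
    (∀ k, (p k).lift 0 ≤ R) ∧ ∀ S : Hyperplane n, {k | p k ∈ S.1}.Finite := by
  have ht : ∀ k : ℕ, (0 : ℝ) < 1 / (k + 1) ∧ (1 : ℝ) / (k + 1) ≤ 1 := fun k =>
    ⟨by positivity, (div_le_one (by positivity)).2 (by linarith [(Nat.cast_nonneg k : (0:ℝ) ≤ k)])⟩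
  have hneg : ∀ k : ℕ, lorentz (n := n + 1) (momentVec n (1 / (k + 1))) (momentVec n (1 / (k + 1)))
      ≤ -1 := fun k => lorentz_momentVec_le (ht k).1.le (ht k).2
  have h0 : ∀ k : ℕ, momentVec n (1 / (k + 1)) 0 = n + 2 := fun k => rfl
  refine ⟨fun k => HypSpace.of (momentVec n (1 / (k + 1))) ((hneg k).trans_lt (by norm_num)),
    n + 2, fun k => ?_, fun S => ?_⟩
  · obtain ⟨a, ha, ha2, hl⟩ := exists_lift_of_pos (momentVec n (1 / (k + 1)))
      ((hneg k).trans_lt (by norm_num)) (by rw [h0]; positivity)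
    have h1 : a ≤ 1 := by nlinarith [hneg k, sq_nonneg a]
    rw [hl, Pi.smul_apply, h0, smul_eq_mul]
    exact mul_le_of_le_one_left (by positivity) h1
  · obtain ⟨v, hv, hS⟩ := exists_eq_perp S.2
    have hv0 : v ≠ 0 := by rintro rfl; simp [lorentz] at hv
    refine ((finite_lorentz_momentVec_eq_zero hv0).preimage
      (f := fun k : ℕ => (1 : ℝ) / (k + 1)) ?_).subset fun k hk => ?_
    · intro a _ b _ hab
      simpa using hab
    · obtain ⟨a, ha, -, hl⟩ := exists_lift_of_pos (momentVec n (1 / (k + 1)))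
        ((hneg k).trans_lt (by norm_num)) (by rw [h0]; positivity)
      rw [mem_ofPred_eq, hS, mem_perp, hl, lorentz_smul_right] at hk
      exact (mul_eq_zero.1 hk).resolve_left ha.ne'

end Moment

/-! ### Invariant measures are proportional to length on segments -/

section Crofton

variable {n : ℕ} {μ : Measure (Hyperplane n)}

theorem measure_meeting_lt_top (hμ : IsInvariantMeasure μ) (x y : HypSpace (n + 1)) :
    μ (meeting x y) < ⊤ :=
  (measure_mono (meeting_subset_normalBall x y)).trans_lt
    (hμ.lt_top_of_isCompact _ (isCompact_normalBall _))

theorem measure_meeting_congr (hμ : IsInvariantMeasure μ) {x y x' y' : HypSpace (n + 1)}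
    (h : hdist x y = hdist x' y') : μ (meeting x y) = μ (meeting x' y') := by
  obtain ⟨g, rfl, rfl⟩ := exists_smul_pair h
  rw [← image_smul_meeting, hμ.invariant g _ (measurableSet_meeting x y)]

/-- The hyperplanes through a given point form a null set: otherwise infinitely many points in
general position in a bounded region would yield infinite measure. -/
theorem measure_meeting_self (hμ : IsInvariantMeasure μ) (x : HypSpace (n + 1)) :
    μ (meeting x x) = 0 := by
  obtain ⟨p, R, hR, hfin⟩ := exists_seq_finite_mem n
  have hmem : ∀ k S, S ∈ meeting (p k) (p k) ↔ p k ∈ S.1 := fun k S => by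
    change (S.1 ∩ _).Nonempty ↔ _
    rw [geodesicSegment_self, Set.inter_singleton_nonempty]
  -- The sets `B N` decrease to the empty set, and all have measure at least `μ (meeting x x)`.
  set B : ℕ → Set (Hyperplane n) := fun N => ⋃ k ∈ Ici N, meeting (p k) (p k) with hB
  have hBm : ∀ N, MeasurableSet (B N) := fun N =>
    MeasurableSet.biUnion (Set.to_countable _) fun k _ => measurableSet_meeting _ _
  have hanti : Antitone B := fun M N hMN =>
    Set.biUnion_subset_biUnion_left (Set.Ici_subset_Ici.2 hMN)
  have hBfin : μ (B 0) ≠ ⊤ := by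
    refine ((measure_mono ?_).trans_lt
      (hμ.lt_top_of_isCompact _ (isCompact_normalBall R))).ne
    exact Set.iUnion₂_subset fun k _ S hS => mem_normalBall ((hmem k S).1 hS) (hR k)
  have hempty : ⋂ N, B N = ∅ := by
    refine Set.eq_empty_iff_forall_notMem.2 fun S hS => ?_
    obtain ⟨N, hN⟩ := (hfin S).bddAbove
    obtain ⟨k, hk, hSk⟩ := Set.mem_iUnion₂.1 (Set.mem_iInter.1 hS (N + 1))
    have := hN ((hmem k S).1 hSk)
    have hk' : N + 1 ≤ k := hk
    omega
  have hlim := tendsto_measure_iInter_atTop (μ := μ) (fun N => (hBm N).nullMeasurableSet) hanti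
    ⟨0, hBfin⟩
  rw [hempty, measure_empty] at hlim
  refine le_antisymm (ge_of_tendsto' hlim fun N => ?_) (zero_le)
  rw [measure_meeting_congr hμ (x' := p N) (y' := p N) (by rw [hdist_self, hdist_self])]
  exact measure_mono (Set.subset_biUnion_of_mem (u := fun k => meeting (p k) (p k))
    (Set.mem_Ici.2 le_rfl))

/-- A geodesic line parametrized by arc length, on the hyperboloid. -/
def axisVec (n : ℕ) (t : ℝ) : Fin (n + 2) → ℝ :=
  Real.cosh t • Pi.single 0 1 + Real.sinh t • Pi.single (Fin.succ 0) 1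

theorem lorentz_axisVec (v : Fin (n + 2) → ℝ) (t : ℝ) :
    lorentz (n := n + 1) v (axisVec n t) =
      -(v 0 * Real.cosh t) + v (Fin.succ 0) * Real.sinh t := by
  rw [axisVec, lorentz_add_right, lorentz_smul_right, lorentz_smul_right, lorentz_single_zero,
    lorentz_single_succ]
  ring

theorem axisVec_zero (t : ℝ) : axisVec n t 0 = Real.cosh t := by
  simp [axisVec]

theorem lorentz_axisVec_axisVec (s t : ℝ) :
    lorentz (n := n + 1) (axisVec n s) (axisVec n t) = -Real.cosh (s - t) := by
  rw [lorentz_axisVec, axisVec_zero, Real.cosh_sub]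
  simp [axisVec]
  ring

theorem lorentz_axisVec_self (t : ℝ) :
    lorentz (n := n + 1) (axisVec n t) (axisVec n t) = -1 := by
  rw [lorentz_axisVec_axisVec, sub_self, Real.cosh_zero]

/-- The points of a geodesic line, parametrized by arc length. -/
def axis (n : ℕ) (t : ℝ) : HypSpace (n + 1) :=
  HypSpace.of (axisVec n t) (by rw [lorentz_axisVec_self]; norm_num)

theorem axis_lift (t : ℝ) : (axis n t).lift = axisVec n t :=
  lift_of _ (lorentz_axisVec_self t) (by rw [axisVec_zero]; exact Real.cosh_pos t)

theorem hdist_axis (s t : ℝ) : hdist (axis n s) (axis n t) = |s - t| :=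
  hdist_eq_of_lorentz (abs_nonneg _)
    (by rw [axis_lift, axis_lift, lorentz_axisVec_axisVec, Real.cosh_abs])

/-- The linear relation between three points of a geodesic line. -/
theorem lorentz_axis_relation (v : Fin (n + 2) → ℝ) (s t : ℝ) :
    Real.sinh (s + t) * lorentz (n := n + 1) v (axis n s).lift =
      Real.sinh t * lorentz (n := n + 1) v (axis n 0).lift +
        Real.sinh s * lorentz (n := n + 1) v (axis n (s + t)).lift := by
  simp only [axis_lift, lorentz_axisVec, Real.sinh_add, Real.cosh_add, Real.cosh_zero,
    Real.sinh_zero]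
  linear_combination (-v 0 * Real.sinh t) * Real.cosh_sq_sub_sinh_sq s

/-- Additivity: by the relation above, the linear functional of a normal vector takes opposite
signs at the ends of a segment exactly when it does so on one of the two parts, and only the
hyperplanes through the common end point of the parts are counted twice. -/
theorem measure_meeting_axis_add (hμ : IsInvariantMeasure μ) {s t : ℝ} (hs : 0 ≤ s)
    (ht : 0 ≤ t) : μ (meeting (axis n 0) (axis n (s + t))) =
      μ (meeting (axis n 0) (axis n s)) + μ (meeting (axis n 0) (axis n t)) := by
  have hshift : μ (meeting (axis n 0) (axis n t)) = μ (meeting (axis n s) (axis n (s + t))) :=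
    measure_meeting_congr hμ (by rw [hdist_axis, hdist_axis]; congr 1; ring)
  rcases hs.eq_or_lt with rfl | hs
  · rw [measure_meeting_self hμ, zero_add, zero_add]
  rcases ht.eq_or_lt with rfl | ht
  · rw [measure_meeting_self hμ, add_zero, add_zero]
  have ha : 0 < Real.sinh t := Real.sinh_pos_iff.2 ht
  have hb : 0 < Real.sinh s := Real.sinh_pos_iff.2 hs
  have hc : 0 < Real.sinh (s + t) := Real.sinh_pos_iff.2 (by linarith)
  have hunion : meeting (n := n) (axis n 0) (axis n (s + t)) =
      meeting (axis n 0) (axis n s) ∪ meeting (axis n s) (axis n (s + t)) := by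
    ext S
    obtain ⟨v, -, hS⟩ := exists_eq_perp S.2
    have h := lorentz_axis_relation v s t
    rw [Set.mem_union, mem_meeting_iff hS, mem_meeting_iff hS, mem_meeting_iff hS]
    set φ₀ := lorentz (n := n + 1) v (axis n 0).lift
    set φ₁ := lorentz (n := n + 1) v (axis n s).lift
    set φ₂ := lorentz (n := n + 1) v (axis n (s + t)).lift
    constructor
    · intro h02
      by_contra! hpos
      have h1 := mul_pos hpos.1 hpos.2
      have h2 : φ₀ * φ₁ * (φ₁ * φ₂) = φ₁ ^ 2 * (φ₀ * φ₂) := by ring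
      rw [h2] at h1
      exact absurd h1 (not_lt.2 (mul_nonpos_of_nonneg_of_nonpos (sq_nonneg _) h02))
    · intro h'
      by_contra! h02
      have e0 : Real.sinh (s + t) * (φ₀ * φ₁) =
          Real.sinh t * φ₀ ^ 2 + Real.sinh s * (φ₀ * φ₂) := by linear_combination φ₀ * h
      have e2 : Real.sinh (s + t) * (φ₁ * φ₂) =
          Real.sinh t * (φ₀ * φ₂) + Real.sinh s * φ₂ ^ 2 := by linear_combination φ₂ * h
      have p0 : 0 < Real.sinh t * φ₀ ^ 2 + Real.sinh s * (φ₀ * φ₂) :=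
        add_pos_of_nonneg_of_pos (mul_nonneg ha.le (sq_nonneg _)) (mul_pos hb h02)
      have p2 : 0 < Real.sinh t * (φ₀ * φ₂) + Real.sinh s * φ₂ ^ 2 :=
        add_pos_of_pos_of_nonneg (mul_pos ha h02) (mul_nonneg hb.le (sq_nonneg _))
      rcases h' with h' | h'
      · exact absurd (e0 ▸ p0) (not_lt.2 (mul_nonpos_of_nonneg_of_nonpos hc.le h'))
      · exact absurd (e2 ▸ p2) (not_lt.2 (mul_nonpos_of_nonneg_of_nonpos hc.le h'))
  have hinter : μ (meeting (axis n 0) (axis n s) ∩ meeting (axis n s) (axis n (s + t))) = 0 := by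
    refine measure_mono_null ?_ (measure_meeting_self hμ (axis n s))
    rintro S ⟨h1, h2⟩
    obtain ⟨v, -, hS⟩ := exists_eq_perp S.2
    have h := lorentz_axis_relation v s t
    rw [mem_meeting_iff hS] at h1 h2 ⊢
    have h3 := mul_nonpos_of_nonneg_of_nonpos ha.le h1
    have h4 := mul_nonpos_of_nonneg_of_nonpos hb.le h2
    by_contra! h5
    have h6 := mul_pos hc h5
    rw [← mul_assoc, h] at h6
    linarith
  rw [hshift, ← measure_union_add_inter _ (measurableSet_meeting _ _), hinter, add_zero, hunion]

/-- Cauchy's functional equation on the half line, for nonnegative functions. -/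
theorem eq_mul_of_add_of_nonneg {f : ℝ → ℝ} (hf : ∀ t, 0 ≤ f t)
    (hadd : ∀ s t, 0 ≤ s → 0 ≤ t → f (s + t) = f s + f t) {t : ℝ} (ht : 0 ≤ t) :
    f t = f 1 * t := by
  have hmono : ∀ s t, 0 ≤ s → s ≤ t → f s ≤ f t := fun s t hs hst => by
    have := hadd s (t - s) hs (by linarith)
    rw [add_sub_cancel] at this
    linarith [hf (t - s)]
  have h0 : f 0 = 0 := by
    have := hadd 0 0 le_rfl le_rfl
    rw [add_zero] at this
    linarith
  have hnat : ∀ (m : ℕ) (s : ℝ), 0 ≤ s → f (m * s) = m * f s := by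
    intro m s hs
    induction m with
    | zero => simp [h0]
    | succ m ih =>
      push_cast
      rw [add_mul, one_mul, hadd _ _ (by positivity) hs, ih]
      ring
  -- By monotonicity `f (m t)` lies between `⌊m t⌋ f 1` and `(⌊m t⌋ + 1) f 1`, so that the error
  -- `m |f t - f 1 t|` stays bounded as `m` grows.
  have hbound : ∀ m : ℕ, (m : ℝ) * |f t - f 1 * t| ≤ f 1 := by
    intro m
    have hmt : 0 ≤ (m : ℝ) * t := by positivity
    have h1 := hmono _ _ (by positivity) (Nat.floor_le hmt)
    have h2 := hmono _ _ hmt (Nat.lt_floor_add_one ((m : ℝ) * t)).le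
    have h3 := hnat ⌊(m : ℝ) * t⌋₊ 1 zero_le_one
    have h4 := hnat (⌊(m : ℝ) * t⌋₊ + 1) 1 zero_le_one
    push_cast at h4
    rw [mul_one] at h3 h4
    rw [hnat m t ht] at h1 h2
    rw [h3] at h1
    rw [h4] at h2
    have h5 := mul_le_mul_of_nonneg_right (Nat.floor_le hmt) (hf 1)
    have h6 := mul_le_mul_of_nonneg_right (Nat.lt_floor_add_one ((m : ℝ) * t)).le (hf 1)
    rw [← abs_of_nonneg (Nat.cast_nonneg (α := ℝ) m), ← abs_mul,
      abs_le]
    constructor <;> nlinarith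
  by_contra hne
  have hpos : 0 < |f t - f 1 * t| := abs_pos.2 (sub_ne_zero.2 hne)
  obtain ⟨m, hm⟩ := exists_nat_gt (f 1 / |f t - f 1 * t|)
  rw [div_lt_iff₀ hpos] at hm
  linarith [hbound m]

/-- The Crofton formula, with the constant normalized on a segment of length one. -/
theorem measure_meeting_eq (hμ : IsInvariantMeasure μ) (x y : HypSpace (n + 1)) :
    μ (meeting x y) =
      ENNReal.ofReal ((μ (meeting (axis n 0) (axis n 1))).toReal * hdist x y) := by
  have h1 : μ (meeting x y) = μ (meeting (axis n 0) (axis n (hdist x y))) :=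
    measure_meeting_congr hμ
      (by rw [hdist_axis, zero_sub, abs_neg, abs_of_nonneg (hdist_nonneg x y)])
  have h2 := eq_mul_of_add_of_nonneg
    (f := fun t => (μ (meeting (axis n 0) (axis n t))).toReal) (fun t => ENNReal.toReal_nonneg)
    (fun s t hs ht => by
      rw [measure_meeting_axis_add hμ hs ht, ENNReal.toReal_add
        (measure_meeting_lt_top hμ _ _).ne (measure_meeting_lt_top hμ _ _).ne])
    (hdist_nonneg x y)
  rw [h1, ← h2, ENNReal.ofReal_toReal (measure_meeting_lt_top hμ _ _).ne]

/-- Both sides of a hyperplane are nonempty: this gives a point on the positive side, and the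
normal vector `-v` one on the other side. -/
theorem exists_timelike_pos {v : Fin (n + 2) → ℝ} (hv : lorentz (n := n + 1) v v = 1) :
    ∃ x : Fin (n + 2) → ℝ, lorentz (n := n + 1) x x < 0 ∧ 0 < x 0 ∧
      0 < lorentz (n := n + 1) v x := by
  obtain ⟨f, -, hf⟩ := isHyperplane_perp (w := v) (by rw [hv]; norm_num)
  have hp : f (origin n) ∈ perp v := hf ▸ Set.mem_range_self _
  set p := f (origin n)
  have hp1 : lorentz (n := n + 1) v p.lift = 0 := hp
  have hp0 := one_le_zero (lift_self p) (lift_pos p)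
  have hd : 0 < 2 * (1 + |v 0|) := by positivity
  -- A point of the hyperplane is moved along `v` by an amount small enough to stay timelike.
  set δ := (2 * (1 + |v 0|))⁻¹ with hδ
  have hδ0 : 0 < δ := inv_pos.2 hd
  have hδ1 : δ * (2 * (1 + |v 0|)) = 1 := inv_mul_cancel₀ hd.ne'
  have hδ2 : δ * |v 0| < 1 / 2 := by nlinarith
  have hδ3 : δ ≤ 1 / 2 := by nlinarith [abs_nonneg (v 0)]
  refine ⟨p.lift + δ • v, ?_, ?_, ?_⟩
  · simp only [lorentz_add_left, lorentz_add_right, lorentz_smul_left, lorentz_smul_right,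
      lorentz_comm p.lift v, hp1, lift_self, hv]
    nlinarith
  · have h1 : δ * -|v 0| ≤ δ * v 0 := mul_le_mul_of_nonneg_left (neg_abs_le _) hδ0.le
    have h2 : (p.lift + δ • v) 0 = p.lift 0 + δ * v 0 := rfl
    rw [h2]
    linarith
  · rw [lorentz_add_right, lorentz_smul_right, hp1, hv]
    linarith

/-- Countably many segments meet every hyperplane. -/
theorem exists_countable_cover (n : ℕ) : ∃ q : ℕ → HypSpace (n + 1),
    ∀ S : Hyperplane n, ∃ i j, S ∈ meeting (q i) (q j) := by
  classical
  set d := TopologicalSpace.denseSeq (Fin (n + 2) → ℝ) with hd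
  set q : ℕ → HypSpace (n + 1) := fun i =>
    if h : lorentz (n := n + 1) (d i) (d i) < 0 then HypSpace.of (d i) h else origin (n + 1) with hq
  have key : ∀ v : Fin (n + 2) → ℝ, lorentz (n := n + 1) v v = 1 →
      ∃ i, 0 < lorentz (n := n + 1) v (q i).lift := by
    intro v hv
    have hopen : IsOpen {x : Fin (n + 2) → ℝ | lorentz (n := n + 1) x x < 0 ∧ 0 < x 0 ∧
        0 < lorentz (n := n + 1) v x} :=
      (isOpen_lt (continuous_id.lorentz continuous_id) continuous_const).inter
        ((isOpen_lt continuous_const (continuous_apply 0)).inter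
          (isOpen_lt continuous_const (continuous_const.lorentz continuous_id)))
    obtain ⟨i, hi⟩ := (TopologicalSpace.denseRange_denseSeq _).exists_mem_open hopen
      (exists_timelike_pos hv)
    refine ⟨i, ?_⟩
    obtain ⟨a, ha, -, hl⟩ := exists_lift_of_pos (d i) hi.1 hi.2.1
    have hqi : q i = HypSpace.of (d i) hi.1 := dif_pos hi.1
    rw [hqi, hl, lorentz_smul_right]
    exact mul_pos ha hi.2.2
  refine ⟨q, fun S => ?_⟩
  obtain ⟨v, hv, hS⟩ := exists_eq_perp S.2
  obtain ⟨i, hi⟩ := key v hv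
  obtain ⟨j, hj⟩ := key (-v) (by rw [lorentz_neg_left, lorentz_neg_right, neg_neg, hv])
  rw [lorentz_neg_left] at hj
  exact ⟨i, j, (mem_meeting_iff hS _ _).2 (mul_nonpos_of_nonneg_of_nonpos hi.le (by linarith))⟩

/-- The Crofton constant is nonzero: otherwise the space of hyperplanes would be a countable union
of null sets. -/
theorem measure_meeting_axis_pos (hμ : IsInvariantMeasure μ) :
    0 < (μ (meeting (axis n 0) (axis n 1))).toReal := by
  refine lt_of_le_of_ne ENNReal.toReal_nonneg fun h => hμ.ne_zero ?_
  obtain ⟨q, hq⟩ := exists_countable_cover n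
  rw [← Measure.measure_univ_eq_zero]
  refine measure_mono_null (t := ⋃ i, ⋃ j, meeting (q i) (q j)) (fun S _ => ?_) ?_
  · obtain ⟨i, j, h⟩ := hq S
    exact Set.mem_iUnion₂.2 ⟨i, j, h⟩
  · refine measure_iUnion_null fun i => measure_iUnion_null fun j => ?_
    rw [measure_meeting_eq hμ, ← h, zero_mul, ENNReal.ofReal_zero]

end Crofton

/-! ### Existence of an invariant measure -/

section Existence

variable {n : ℕ}

/-- The Gram matrix of the Lorentz form. -/
def gram (n : ℕ) : Matrix (Fin (n + 1)) (Fin (n + 1)) ℝ :=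
  Matrix.diagonal (Fin.cons (-1) fun _ => 1)

theorem lorentz_eq_dotProduct (z w : Fin (n + 1) → ℝ) :
    lorentz z w = z ⬝ᵥ gram n *ᵥ w := by
  simp [lorentz, gram, dotProduct, Matrix.mulVec_diagonal, Fin.sum_univ_succ]

theorem abs_det_eq_one (g : lorentzGroup n) :
    |(g.1.1 : Matrix (Fin (n + 1)) (Fin (n + 1)) ℝ).det| = 1 := by
  set M : Matrix (Fin (n + 1)) (Fin (n + 1)) ℝ := g.1.1 with hM
  have h : Mᵀ * gram n * M = gram n := by
    refine Matrix.ext_of_mulVec_single fun j => ?_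
    refine dotProduct_eq _ _ fun z => ?_
    rw [dotProduct_comm, dotProduct_comm _ z, ← lorentz_eq_dotProduct, ← g.2,
      lorentz_eq_dotProduct]
    change _ = (M *ᵥ z) ⬝ᵥ gram n *ᵥ (M *ᵥ Pi.single j 1)
    rw [← Matrix.mulVec_mulVec, ← Matrix.mulVec_mulVec, Matrix.dotProduct_mulVec,
      Matrix.vecMul_transpose]
  have hJ : (gram n).det ≠ 0 := by
    rw [gram, Matrix.det_diagonal, Fin.prod_univ_succ]
    simp
  have hdet := congrArg Matrix.det h
  rw [Matrix.det_mul, Matrix.det_mul, Matrix.det_transpose] at hdet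
  have h2 : M.det ^ 2 = 1 := mul_right_cancel₀ hJ (by linear_combination hdet)
  exact (pow_eq_one_iff_of_nonneg (abs_nonneg _) two_ne_zero).1 (by rw [sq_abs, h2])

theorem volume_preimage_smul (g : lorentzGroup n) {B : Set (Fin (n + 1) → ℝ)}
    (hB : MeasurableSet B) : volume ((fun w => g.1 • w) ⁻¹' B) = volume B := by
  have hdet := abs_det_eq_one g
  have hne : (g.1.1 : Matrix (Fin (n + 1)) (Fin (n + 1)) ℝ).det ≠ 0 := fun h => by
    rw [h, abs_zero] at hdet
    exact zero_ne_one hdet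
  have hmap := Real.map_matrix_volume_pi_eq_smul_volume_pi hne
  rw [abs_inv, hdet, inv_one, ENNReal.ofReal_one, one_smul] at hmap
  have hmeas : Measurable (Matrix.toLin' (g.1.1 : Matrix (Fin (n + 1)) (Fin (n + 1)) ℝ)) :=
    (LinearMap.continuous_of_finiteDimensional _).measurable
  conv_rhs => rw [← hmap, Measure.map_apply hmeas hB]
  rfl

/-- The spacelike vectors of length at most one. -/
def spacelikeShell (n : ℕ) : Set (Fin (n + 2) → ℝ) :=
  {w | 0 < lorentz (n := n + 1) w w ∧ lorentz (n := n + 1) w w ≤ 1}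

theorem measurableSet_spacelikeShell : MeasurableSet (spacelikeShell n) :=
  (isOpen_spacelike.measurableSet).inter
    (isClosed_le (continuous_id.lorentz continuous_id) continuous_const).measurableSet

/-- The invariant measure on the space of hyperplanes: the cone measure obtained from Lebesgue
measure on the spacelike vectors of length at most one by passing to orthogonal hyperplanes. -/
def coneMeasure (n : ℕ) : Measure (Hyperplane n) :=
  (volume.restrict (spacelikeShell n)).map normalMap

theorem coneMeasure_apply {A : Set (Hyperplane n)} (hA : MeasurableSet A) :
    coneMeasure n A = volume (normalMap ⁻¹' A ∩ spacelikeShell n) := by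
  rw [coneMeasure, Measure.map_apply measurable_normalMap hA,
    Measure.restrict_apply (measurable_normalMap hA)]

/-- The hyperplanes at distance less than `arcosh R` from the origin. -/
def nearOrigin (n : ℕ) (R : ℝ) : Set (Hyperplane n) := {S | ∃ p ∈ S.1, p.lift 0 < R}

theorem isOpen_nearOrigin (R : ℝ) : IsOpen (nearOrigin n R) := by
  refine isOpen_coinduced.2 ?_
  have : (fun g : lorentzGroup (n + 1) => g • stdHyperplane n) ⁻¹' nearOrigin n R =
      ⋃ p ∈ (stdHyperplane n).1, {g : lorentzGroup (n + 1) | |(g.1 • p.lift) 0| < R} := by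
    ext g
    have hl : ∀ p : HypSpace (n + 1), (g • p).lift 0 = |(g.1 • p.lift) 0| := fun p => by
      obtain ⟨a, ha, h⟩ := lift_smul g p
      have h1 : |a| = 1 :=
        (pow_eq_one_iff_of_nonneg (abs_nonneg _) two_ne_zero).1 (by rw [sq_abs, ha])
      rw [← abs_of_pos (lift_pos (g • p)), h, Pi.smul_apply, smul_eq_mul, abs_mul, h1, one_mul]
    rw [Set.mem_iUnion₂]
    constructor
    · rintro ⟨_, ⟨p, hp, rfl⟩, hR⟩
      exact ⟨p, hp, (hl p).symm.trans_lt hR⟩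
    · rintro ⟨p, hp, hR⟩
      exact ⟨g • p, Set.smul_mem_smul_set hp, (hl p).trans_lt hR⟩
  rw [this]
  refine isOpen_biUnion fun p _ => isOpen_lt ?_ continuous_const
  exact continuous_abs.comp ((continuous_apply 0).comp (continuous_smul_vec _))

theorem coneMeasure_nearOrigin_lt_top (R : ℝ) : coneMeasure n (nearOrigin n R) < ⊤ := by
  rw [coneMeasure_apply (isOpen_nearOrigin R).measurableSet]
  refine (measure_mono (t := Metric.closedBall 0 (|R| + 1)) ?_).trans_lt measure_closedBall_lt_top
  rintro w ⟨⟨p, hp, hR⟩, hw0, hw1⟩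
  rw [normalMap_val hw0] at hp
  have h := sq_zero_le_of_orthogonal hp (lift_self p)
  have h1 := one_le_sq_zero (lift_self p)
  have h2 := lift_pos p
  rw [mem_closedBall_zero_iff]
  refine norm_le_of_lorentz_le hw1 (sq_le_sq.1 ?_)
  nlinarith

theorem isInvariantMeasure_coneMeasure (n : ℕ) : IsInvariantMeasure (coneMeasure n) where
  ne_zero := by
    intro h
    have h1 : coneMeasure n univ = 0 := by rw [h]; simp
    rw [coneMeasure_apply MeasurableSet.univ, preimage_univ, univ_inter] at h1
    have hopen : IsOpen {w : Fin (n + 2) → ℝ | 0 < lorentz (n := n + 1) w w ∧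
        lorentz (n := n + 1) w w < 1} :=
      isOpen_spacelike.inter (isOpen_lt (continuous_id.lorentz continuous_id) continuous_const)
    refine (hopen.measure_pos volume ⟨(1 / 2 : ℝ) • lastVec n, ?_⟩).ne'
      (measure_mono_null (t := spacelikeShell n) (fun w hw => And.intro hw.1 hw.2.le) h1)
    change 0 < lorentz _ _ ∧ lorentz _ _ < 1
    rw [lorentz_smul, lorentz_lastVec_self]
    norm_num
  invariant := by
    intro g A hA
    have himage : (fun S : Hyperplane n => g • S) '' A = (fun S => g⁻¹ • S) ⁻¹' A :=
      congrFun (Set.image_eq_preimage_of_inverse (inv_smul_smul g) (smul_inv_smul g)) A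
    have hA' : MeasurableSet ((fun S : Hyperplane n => g⁻¹ • S) ⁻¹' A) :=
      (continuous_smul_hyperplane g⁻¹).measurable hA
    rw [himage, coneMeasure_apply hA', coneMeasure_apply hA,
      ← volume_preimage_smul g⁻¹ ((measurable_normalMap hA).inter measurableSet_spacelikeShell)]
    congr 1
    ext w
    have hshell : g⁻¹.1 • w ∈ spacelikeShell n ↔ w ∈ spacelikeShell n := by
      change (_ ∧ _) ↔ (_ ∧ _)
      rw [g⁻¹.2]
    change (g⁻¹ • normalMap w ∈ A ∧ w ∈ spacelikeShell n) ↔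
      (normalMap (g⁻¹.1 • w) ∈ A ∧ g⁻¹.1 • w ∈ spacelikeShell n)
    rw [hshell]
    refine and_congr_left fun hw => ?_
    rw [normalMap_smul _ hw.1]
  lt_top_of_isCompact := by
    intro A hA
    have hcover : A ⊆ ⋃ R : ℝ, nearOrigin n R := fun S _ => by
      obtain ⟨f, -, hf⟩ := S.2
      exact Set.mem_iUnion.2 ⟨(f (origin n)).lift 0 + 1, f (origin n),
        hf ▸ Set.mem_range_self _, lt_add_one _⟩
    have hmono : Monotone (nearOrigin n) :=
      fun R R' hRR' S ⟨p, hp, h⟩ => ⟨p, hp, h.trans_le hRR'⟩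
    obtain ⟨R, hR⟩ := hA.elim_directed_cover _ isOpen_nearOrigin hcover hmono.directed_le
    exact (measure_mono hR).trans_lt (coneMeasure_nearOrigin_lt_top R)

end Existence

end HypCrofton

end

theorem proposition2p1 (n : ℕ) :
    (∃ μ : MeasureTheory.Measure (HypCrofton.Hyperplane n), HypCrofton.IsInvariantMeasure μ) ∧
    ∀ μ : MeasureTheory.Measure (HypCrofton.Hyperplane n), HypCrofton.IsInvariantMeasure μ →
      ∃ k : ℝ, 0 < k ∧ ∀ x y : HypCrofton.HypSpace (n + 1),
        MeasurableSet {S : HypCrofton.Hyperplane n |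
            (S.1 ∩ HypCrofton.geodesicSegment x y).Nonempty} ∧
        μ {S : HypCrofton.Hyperplane n | (S.1 ∩ HypCrofton.geodesicSegment x y).Nonempty} =
          ENNReal.ofReal (k * HypCrofton.hdist x y) :=
  ⟨⟨_, HypCrofton.isInvariantMeasure_coneMeasure n⟩, fun _ hμ =>
    ⟨_, HypCrofton.measure_meeting_axis_pos hμ, fun x y =>
      ⟨HypCrofton.measurableSet_meeting x y, HypCrofton.measure_meeting_eq hμ x y⟩⟩⟩
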